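/- \textbf{Theorem.} \emph{Every property tester for having a valid DFS numbering in the labeled bounded-degree graph model has query complexity $\Omega(n^{1/3})$.} \emph{DFS numbering.} Let $G=(V,E)$ be an undirected graph on $n$ vertices. A bijection $\mathrm{num}:V\to\{1,\dots,n\}$ is a (valid) DFS numbering of $G$ if depth-first search, run on $G$ with some order of the vertices in its outer loop and some order of the neighbors of each vertex in the inner loops, discovers the vertices in the order $\mathrm{num}^{-1}(1),\dots,\mathrm{num}^{-1}(n)$. For $\varepsilon>0$ and a graph $G=(V,E)$ of maximum degree at most $d$, the labeling $\mathrm{num}$ is \emph{$\varepsilon$-far} from having a valid DFS numbering if $|E\,\triangle\,E'|>\varepsilon n$ for every graph $G'=(V,E')$ of maximum degree at most $d$ for which $\mathrm{num}$ is a valid DFS numbering. \emph{Model.} The input is a graph $G$ with vertex set $V=\{1,\dots,n\}$ and maximum degree at most $d$, given by adjacency lists in arbitrary order, together with a bijection $\mathrm{num}:V\to\{1,\dots,n\}$. A randomized algorithm knows $n$ and $d$ and accesses the input only by adaptive queries of two kinds: the $i$-th neighbor of a vertex $v$ (where $1\le i\le d$; a special symbol is returned if $v$ has fewer than $i$ neighbors),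 and the label $\mathrm{num}(v)$ of a vertex $v$. It is a \emph{property tester} with proximity parameter $\varepsilon$ if it accepts with probability at least $2/3$ every input for which $\mathrm{num}$ is a valid DFS numbering of $G$, and rejects with probability at least $2/3$ every input that is $\varepsilon$-far from having a valid DFS numbering. Its \emph{query complexity} is the maximum number of queries over all inputs (for the given $n$ and $d$) and all outcomes of its internal randomness. \emph{Claim.} There are absolute constants $c>0$ and $n_0$ such that for every degree bound $d\ge 3$, every $0<\varepsilon\le\frac1{33}$ and every $n\ge n_0$, every property tester with proximity parameter $\varepsilon$ for labeled graphs with $n$ vertices and maximum degree at most $d$ has query complexity at least $c\,n^{1/3}$. -/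

import Mathlib

open scoped symmDiff

namespace DFSTesting

/-! ### Depth-first search and DFS numberings -/

/-- Big-step semantics of the `for`-loop of depth-first search on a graph whose neighbourhoods
are processed in the orders `order`. `Loop order l s s'` means: starting in the state `s`, the loop
`for u in l do (if u is undiscovered then visit u)` ends in the state `s'`. A state is the list of
the vertices discovered so far, in the order of their discovery. Visiting `u` marks `u` as
discovered (giving it the smallest unused number) and then runs the loop over the neighbours
of `u`. -/
inductive Loop {V : Type*} (order : V → List V) : List V → List V → List V → Prop
  | nil (s : List V) : Loop order [] s s
  | skip {u : V} {l s s' : List V} (hu : u ∈ s) (hl : Loop order l s s') :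
      Loop order (u :: l) s s'
  | visit {u : V} {l s s' s'' : List V} (hu : u ∉ s)
      (hv : Loop order (order u) (s ++ [u]) s') (hl : Loop order l s' s'') :
      Loop order (u :: l) s s''

/-- `num` is a DFS numbering of `G`: for some order `outer` of all the vertices in the outer loop
and some orders `order v` of the neighbours of each `v` in the inner loops, depth-first search
discovers the vertices in the order given by `num`. Numbers are counted from `0`: the
value `k : Fin n` stands for the number `k + 1` of `{1, …, n}`. -/
def IsDFSNumbering {n : ℕ} {V : Type*} (G : SimpleGraph V) (num : V ≃ Fin n) : Prop :=
  ∃ (outer : List V) (order : V → List V) (s : List V),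
    (outer.Nodup ∧ ∀ v, v ∈ outer) ∧
    (∀ v, (order v).Nodup ∧ ∀ u, u ∈ order v ↔ G.Adj v u) ∧
    Loop order outer [] s ∧
    ∀ v, s[(num v : ℕ)]? = some v

/-- `num` is `ε`-far from being a DFS numbering of the graph `G` on `n` vertices, with respect to
the degree bound `d`: more than `ε n` edge insertions and deletions are needed to turn `G` into a
graph of maximum degree at most `d` for which `num` is a valid DFS numbering. -/
def IsFar {n : ℕ} (d : ℕ) (ε : ℝ) (G : SimpleGraph (Fin n)) (num : Fin n ≃ Fin n) : Prop :=
  ∀ G' : SimpleGraph (Fin n), (∀ v, (G'.neighborSet v).ncard ≤ d) → IsDFSNumbering G' num →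
    ε * (n : ℝ) < ((G.edgeSet ∆ G'.edgeSet).ncard : ℝ)

/-! ### The bounded-degree model for labeled graphs -/

/-- An input of the labeled bounded-degree model: a graph on `n` vertices of maximum degree at
most `d`, given by its adjacency lists (in an arbitrary order), with a bijective labeling. -/
structure LabeledGraph (n d : ℕ) where
  graph : SimpleGraph (Fin n)
  adj : Fin n → List (Fin n)
  mem_adj : ∀ v u, u ∈ adj v ↔ graph.Adj v u
  nodup_adj : ∀ v, (adj v).Nodup
  length_adj_le : ∀ v, (adj v).length ≤ d
  label : Fin n ≃ Fin n

/-- Deterministic adaptive query algorithms that know `n` and `d`. A neighbor query `(v, i)` asks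
for the `i`-th neighbor of the vertex `v` (the answer is `none` if `v` has fewer neighbors), a label
query asks for the label of the vertex `v`; the algorithm continues depending on the answer, and
finally outputs `true` (accept) or `false` (reject). -/
inductive QueryAlg (n d : ℕ) : Type
  | output (b : Bool) : QueryAlg n d
  | neighborQuery (v : Fin n) (i : Fin d) (next : Option (Fin n) → QueryAlg n d) : QueryAlg n d
  | labelQuery (v : Fin n) (next : Fin n → QueryAlg n d) : QueryAlg n d

/-- The output of a query algorithm on the input `I`. -/
def QueryAlg.run {n d : ℕ} (I : LabeledGraph n d) : QueryAlg n d → Bool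
  | .output b => b
  | .neighborQuery v i next => (next (I.adj v)[(i : ℕ)]?).run I
  | .labelQuery v next => (next (I.label v)).run I

/-- The number of oracle queries that a query algorithm makes on the input `I`. -/
def QueryAlg.numQueries {n d : ℕ} (I : LabeledGraph n d) : QueryAlg n d → ℕ
  | .output _ => 0
  | .neighborQuery v i next => (next (I.adj v)[(i : ℕ)]?).numQueries I + 1
  | .labelQuery v next => (next (I.label v)).numQueries I + 1

/-- A randomized query algorithm is a probability distribution on the (countably many)
deterministic ones. This is the probability that it outputs `b` on the input `I`. -/
noncomputable def outputProb {n d : ℕ} (A : PMF (QueryAlg n d)) (I : LabeledGraph n d)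
    (b : Bool) : ENNReal :=
  A.map (QueryAlg.run I) b

/-- `A` is a property tester, with two-sided error and proximity parameter `ε`, for having a valid
DFS numbering, on labeled graphs with `n` vertices and maximum degree at most `d`. -/
def IsDFSTester {n d : ℕ} (ε : ℝ) (A : PMF (QueryAlg n d)) : Prop :=
  ∀ I : LabeledGraph n d,
    (IsDFSNumbering I.graph I.label → 2 / 3 ≤ outputProb A I true) ∧
    (IsFar d ε I.graph I.label → 2 / 3 ≤ outputProb A I false)

/-- The query complexity of `A`: the maximum number of queries over all inputs and all outcomes
of the internal randomness (`⊤` if there is no bound). -/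
noncomputable def queryComplexity {n d : ℕ} (A : PMF (QueryAlg n d)) : ℕ∞ :=
  ⨆ (I : LabeledGraph n d) (T ∈ A.support), (T.numQueries I : ℕ∞)

end DFSTesting

namespace DFSTesting

/-! ### Properties of runs of depth-first search -/

/-! The argument compares random valid inputs with random far inputs. The labels are cut into blocks
of `7 * L` consecutive numbers carrying a forest; `y` governs the edges inside one part of the block
("first half") and `z` those inside another ("second half"). If `y = z`, the numbers are a preorder
of the forest, hence a DFS numbering (`IsPreorder.isDFSNumbering`). If `y = false` and `z = true`,
two bundles of `L` edges cross, and by the interval property of DFS (`IsDFSNumbering.exists_adj`)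
repairing the block costs at least `L` edges (`exists_mem_symmDiff`).

Blocks are paired, with opposite values of `y` fixed by one random bit per pair, so every full pair
of a crossed input has a bad block and the input is far (`isFar_crossedInput`). An algorithm that
never sees both halves of one pair cannot tell the two kinds of input apart: flipping the bits of
the pairs seen in a second half turns a nested input into a crossed one with the same answers,
injectively (`card_run_eq_le`).

The two halves are separated by path segments of length about `L`. With `q < L` queries, walking
along edges cannot bridge them, so seeing both halves requires a query that hits an already known
pair by chance. Under a uniformly random labeling a query does this with probability at most `q * 14
* L / (n - 2 * q)`, so the total probability is `O(q ^ 2 * L / n)` (`card_spread_queried_le`). With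
`L = q + 1`, averaging over the random inputs gives `n = O(q ^ 3)`. -/

/-- What a run of the loop guarantees: it only appends vertices, it discovers all vertices of the
list, and the vertices which it discovers satisfy the interval property of depth-first search. -/
structure LoopSpec {V : Type*} (order : V → List V) (l s s' : List V) : Prop where
  isPrefix : s <+: s'
  nodup : s.Nodup → s'.Nodup
  mem : ∀ u ∈ l, u ∈ s'
  parent : ∀ i b, s.length ≤ i → s'[i]? = some b →
    b ∈ l ∨ ∃ j w, s.length ≤ j ∧ j < i ∧ s'[j]? = some w ∧ b ∈ order w
  interval : ∀ i a, s.length ≤ i → s'[i]? = some a → ∀ c ∈ order a,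
    ∃ m, s'[m]? = some c ∧ ∀ k b, i < k → k < m → s'[k]? = some b →
      ∃ j w, i ≤ j ∧ j < k ∧ s'[j]? = some w ∧ b ∈ order w

theorem getElem?_eq_of_prefix {V : Type*} {s t : List V} (h : s <+: t) {i : ℕ}
    (hi : i < s.length) : t[i]? = s[i]? := by
  obtain ⟨r, rfl⟩ := h
  exact List.getElem?_append_left hi

theorem getElem?_of_prefix {V : Type*} {s t : List V} (h : s <+: t) {i : ℕ} {a : V}
    (hi : s[i]? = some a) : t[i]? = some a := by
  rw [getElem?_eq_of_prefix h, hi]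
  exact (List.getElem?_eq_some_iff.1 hi).1

/-- Whatever is discovered between `a` and the end of the loop over `order a` is found inside the
recursive calls below `a`. By then every `c ∈ order a` is discovered, which gives `interval`;
`parent` is the auxiliary statement that the induction needs for this. -/
theorem Loop.spec {V : Type*} {order : V → List V} {l s s' : List V}
    (h : Loop order l s s') : LoopSpec order l s s' := by
  induction h with
  | nil s =>
    have key : ∀ (i : ℕ) (b : V), s.length ≤ i → s[i]? = some b → False := by
      intro i b hi hb
      have := (List.getElem?_eq_some_iff.1 hb).1
      omega
    exact ⟨List.prefix_rfl, id, by simp, fun i b hi hb => (key i b hi hb).elim,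
      fun i b hi hb => (key i b hi hb).elim⟩
  | @skip u l s s' hu hl ih =>
    refine ⟨ih.isPrefix, ih.nodup, ?_, ?_, ih.interval⟩
    · intro v hv
      rcases List.mem_cons.1 hv with rfl | hv
      · exact ih.isPrefix.subset hu
      · exact ih.mem v hv
    · intro i b hi hb
      rcases ih.parent i b hi hb with h | h
      · exact Or.inl (List.mem_cons_of_mem _ h)
      · exact Or.inr h
  | @visit u l s s' s'' hu hv hl ih1 ih2 =>
    have hs : s <+: s' := (List.prefix_append s [u]).trans ih1.isPrefix
    have hlen : s.length + 1 ≤ s'.length := by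
      simpa using ih1.isPrefix.length_le
    have hu' : s'[s.length]? = some u := getElem?_of_prefix ih1.isPrefix (by simp)
    have hu'' := getElem?_of_prefix ih2.isPrefix hu'
    -- During the inner loop, vertices of `order u` have the discoverer `u`, at index `s.length`;
    -- all others have one found later in the same loop.
    have parent1 : ∀ i b, s.length < i → i < s'.length → s''[i]? = some b →
        ∃ j w, s.length ≤ j ∧ j < i ∧ s''[j]? = some w ∧ b ∈ order w := by
      intro i b hi hi' hb
      rw [getElem?_eq_of_prefix ih2.isPrefix hi'] at hb
      rcases ih1.parent i b (by simpa using hi) hb with h | ⟨j, w, hj, hji, hw, hbw⟩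
      · exact ⟨s.length, u, le_rfl, hi, hu'', h⟩
      · simp only [List.length_append, List.length_singleton] at hj
        exact ⟨j, w, by omega, hji, getElem?_of_prefix ih2.isPrefix hw, hbw⟩
    refine ⟨hs.trans ih2.isPrefix, fun hn => ih2.nodup (ih1.nodup ?_), ?_, ?_, ?_⟩
    · rw [List.nodup_append]
      refine ⟨hn, by simp, ?_⟩
      rintro a ha b hb rfl
      simp only [List.mem_singleton] at hb
      exact hu (hb ▸ ha)
    · intro v hv'
      rcases List.mem_cons.1 hv' with rfl | hv'
      · exact List.mem_of_getElem? hu''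
      · exact ih2.mem v hv'
    · intro i b hi hb
      rcases lt_or_ge i s'.length with hi' | hi'
      · rcases hi.eq_or_lt with rfl | hi
        · rw [hu''] at hb
          cases hb
          exact Or.inl List.mem_cons_self
        · exact Or.inr (parent1 i b hi hi' hb)
      · rcases ih2.parent i b hi' hb with h | ⟨j, w, hj, h⟩
        · exact Or.inl (List.mem_cons_of_mem _ h)
        · exact Or.inr ⟨j, w, by omega, h⟩
    · intro i a hi ha c hc
      rcases lt_or_ge i s'.length with hi' | hi'
      · rcases hi.eq_or_lt with rfl | hi
        · rw [hu''] at ha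
          cases ha
          obtain ⟨m, hm⟩ := List.mem_iff_getElem?.1 (ih1.mem c hc)
          have hmlt := (List.getElem?_eq_some_iff.1 hm).1
          exact ⟨m, getElem?_of_prefix ih2.isPrefix hm, fun k b hk hkm hb =>
            parent1 k b hk (by omega) hb⟩
        · rw [getElem?_eq_of_prefix ih2.isPrefix hi'] at ha
          obtain ⟨m, hm, h⟩ := ih1.interval i a (by simpa using hi) ha c hc
          have hmlt := (List.getElem?_eq_some_iff.1 hm).1
          refine ⟨m, getElem?_of_prefix ih2.isPrefix hm, fun k b hk hkm hb => ?_⟩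
          rw [getElem?_eq_of_prefix ih2.isPrefix (by omega)] at hb
          obtain ⟨j, w, h1, h2, h3, h4⟩ := h k b hk hkm hb
          exact ⟨j, w, h1, h2, getElem?_of_prefix ih2.isPrefix h3, h4⟩
      · exact ih2.interval i a hi' ha c hc

/-- In a DFS numbering, if `b` lies strictly between the ends `a` and `c` of an edge, then `b` has
a neighbor which precedes it, but does not precede `a`. -/
theorem IsDFSNumbering.exists_adj {n : ℕ} {V : Type*} {G : SimpleGraph V} {num : V ≃ Fin n}
    (h : IsDFSNumbering G num) {a b c : V} (hac : G.Adj a c) (hab : num a < num b)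
    (hbc : num b < num c) : ∃ w, G.Adj w b ∧ num a ≤ num w ∧ num w < num b := by
  obtain ⟨outer, order, s, -, horder, hloop, hs⟩ := h
  have spec := hloop.spec
  have hnd : s.Nodup := spec.nodup List.nodup_nil
  have hidx : ∀ (i : ℕ) (v : V), s[i]? = some v → i = num v := fun i v hi =>
    (List.getElem?_inj (List.getElem?_eq_some_iff.1 hi).1 hnd).1 (hi.trans (hs v).symm)
  obtain ⟨m, hm, h⟩ := spec.interval (num a) a (Nat.zero_le _) (hs a) c ((horder a).2 c |>.2 hac)
  have := hidx m c hm
  subst this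
  obtain ⟨j, w, h1, h2, h3, h4⟩ := h (num b) b hab hbc (hs b)
  have := hidx j w h3
  subst this
  exact ⟨w, ((horder w).2 b).1 h4, h1, h2⟩

/-! ### Forests given by parent functions -/

/-- The adjacency relation of the forest in which `par v` is the parent of `v` if `par v ≠ v`, and
`v` is a root otherwise. -/
def ParAdj (par : ℕ → ℕ) (u v : ℕ) : Prop := u ≠ v ∧ (par u = v ∨ par v = u)

instance (par : ℕ → ℕ) (u v : ℕ) : Decidable (ParAdj par u v) :=
  inferInstanceAs (Decidable (_ ∧ _))

theorem ParAdj.symm {par : ℕ → ℕ} {u v : ℕ} (h : ParAdj par u v) : ParAdj par v u :=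
  ⟨h.1.symm, h.2.symm⟩

/-- The numbers of the vertices form a preorder of the forest. -/
structure IsPreorder (par : ℕ → ℕ) : Prop where
  le : ∀ v, par v ≤ v
  nested : ∀ v w, par v < w → w < v → par v ≤ par w ∧ par w < w

/-- The first number beyond the subtree of `v`, among the numbers up to `n`. -/
theorem IsPreorder.exists_end {par : ℕ → ℕ} (n v : ℕ) (hv : v < n) :
    ∃ e, v < e ∧ e ≤ n ∧ (∀ k, v < k → k < e → v ≤ par k ∧ par k < k) ∧
      (e < n → par e < v ∨ e ≤ par e) := by
  classical
  have hex : ∃ e, v < e ∧ (n ≤ e ∨ par e < v ∨ e ≤ par e) := ⟨n, hv, Or.inl le_rfl⟩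
  have h := Nat.find_spec hex
  have hmin : ∀ k, k < Nat.find hex → ¬ (v < k ∧ (n ≤ k ∨ par k < v ∨ k ≤ par k)) :=
    fun k hk => Nat.find_min hex hk
  have hle : Nat.find hex ≤ n := Nat.find_min' hex ⟨hv, Or.inl le_rfl⟩
  refine ⟨Nat.find hex, h.1, hle, fun k hk hke => ?_, fun hlt => ?_⟩
  · have := hmin k hke
    omega
  · have := h.2
    omega

section Preorder

variable {n : ℕ} {V : Type*} (num : V ≃ Fin n)

/-- The list of the vertices with numbers less than `k`, in the order of their numbers. -/
def firstVertices (k : ℕ) : List V := ((List.finRange n).map num.symm).take k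

theorem getElem?_firstVertices (k : ℕ) (v : V) (h : (num v : ℕ) < k) :
    (firstVertices num k)[(num v : ℕ)]? = some v := by
  simp [firstVertices, h]

theorem mem_firstVertices (k : ℕ) (v : V) : v ∈ firstVertices num k ↔ (num v : ℕ) < k := by
  constructor
  · intro h
    obtain ⟨i, hi⟩ := List.mem_iff_getElem?.1 h
    simp only [firstVertices, List.getElem?_take] at hi
    split_ifs at hi with hik
    simp only [List.getElem?_map, Option.map_eq_some_iff] at hi
    obtain ⟨a, ha, rfl⟩ := hi
    obtain ⟨h1, h2⟩ := List.getElem?_eq_some_iff.1 ha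
    rw [List.getElem_finRange] at h2
    subst h2
    simpa using hik
  · exact fun h => List.mem_of_getElem? (getElem?_firstVertices num k v h)

theorem firstVertices_succ (v : V) :
    firstVertices num (num v) ++ [v] = firstVertices num (num v + 1) := by
  rw [firstVertices, firstVertices, List.take_add_one]
  simp

variable {num} {par : ℕ → ℕ} {order : V → List V}

/-- The invariant is that the discovered vertices are exactly those with numbers below `k`, where
`k` is the next child of `v` or the end `e` of its subtree. In a preorder the subtrees of the
children tile the numbers from `v + 1` to `e`, so scanning the neighbors in increasing order meets
each child just when it is due. -/
theorem loop_children (hpar : IsPreorder par) {v : V} {e : ℕ}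
    (hve : (num v : ℕ) < e)
    (he : ∀ k, (num v : ℕ) < k → k < e → (num v : ℕ) ≤ par k ∧ par k < k) (hen : e ≤ n)
    (he' : e < n → par e < num v ∨ e ≤ par e)
    (ih : ∀ u : V, num v < num u → ∃ e', (num u : ℕ) < e' ∧ e' ≤ n ∧
      (∀ k, (num u : ℕ) < k → k < e' → (num u : ℕ) ≤ par k ∧ par k < k) ∧
      (e' < n → par e' < num u ∨ e' ≤ par e') ∧
      Loop order (order u) (firstVertices num (num u + 1)) (firstVertices num e')) :
    ∀ (l : List V) (k : ℕ), l.Pairwise (fun a b => num a < num b) → (num v : ℕ) < k →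
      (k = e ∨ k < e ∧ par k = num v) →
      (∀ u ∈ l, (num u : ℕ) < k ∨ (num v : ℕ) < num u ∧ par (num u) = num v) →
      (∀ u, k ≤ num u → par (num u) = num v → u ∈ l) →
      Loop order l (firstVertices num k) (firstVertices num e) := by
  -- A child beyond `e` would enclose `e` in the interval of its parent edge, and nestedness would
  -- put `e` into the subtree of `v`.
  have child_lt : ∀ u : V, (num v : ℕ) < num u → par (num u) = num v → (num u : ℕ) < e := by
    intro u hu hp
    by_contra! hle
    rcases hle.eq_or_lt with h | h
    · have := he' (by omega)
      rw [h] at this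
      omega
    · have := hpar.nested (num u) e (by omega) h
      have := he' (by omega)
      omega
  intro l
  induction l with
  | nil =>
    intro k _ hvk hk _ hall
    rcases hk with rfl | ⟨hke, hk⟩
    · exact Loop.nil _
    · have := hall (num.symm ⟨k, by omega⟩) (by simp) (by simpa using hk)
      simp at this
  | cons u l ihl =>
    intro k hsort hvk hk hmem hall
    rw [List.pairwise_cons] at hsort
    rcases lt_or_ge (num u : ℕ) k with huk | huk
    · refine Loop.skip ((mem_firstVertices num k u).2 huk) (ihl k hsort.2 hvk hk
        (fun w hw => hmem w (List.mem_cons_of_mem _ hw)) fun w hw hp => ?_)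
      rcases List.mem_cons.1 (hall w hw hp) with rfl | h
      · omega
      · exact h
    · have hu := (hmem u List.mem_cons_self).resolve_left (by omega)
      have hue := child_lt u hu.1 hu.2
      obtain ⟨hke, hkp⟩ := hk.resolve_left (by omega)
      have hku : k = num u := by
        have := hall (num.symm ⟨k, by omega⟩) (by simp) (by simpa using hkp)
        rcases List.mem_cons.1 this with h | h
        · rw [← h]; simp
        · have := hsort.1 _ h
          simp only [Equiv.apply_symm_apply, Fin.lt_def] at this
          omega
      subst hku
      obtain ⟨e', h1, h2, h3, h4, h5⟩ := ih u hu.1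
      have hee : e' ≤ e := by
        by_contra! hlt
        have := h3 e (by omega) hlt
        have := he' (by omega)
        omega
      refine Loop.visit (s' := firstVertices num e') (by simp [mem_firstVertices])
        (by rw [firstVertices_succ]; exact h5) (ihl e' hsort.2 (by omega) ?_ ?_ ?_)
      · rcases hee.eq_or_lt with h | h
        · exact Or.inl h
        · refine Or.inr ⟨h, ?_⟩
          have h6 := he e' (by omega) h
          have h7 := h4 (by omega)
          -- A parent of `e'` strictly between `v` and `u` would, by nestedness applied to `u`, be
          -- at most `par u = v`.
          by_contra hne
          have := hpar.nested e' (num u) (by omega) h1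
          omega
      · exact fun w hw => (hmem w (List.mem_cons_of_mem _ hw)).imp (fun h => by omega) id
      · intro w hw hp
        rcases List.mem_cons.1 (hall w (by omega) hp) with rfl | h
        · omega
        · exact h

theorem exists_loop_subtree (hpar : IsPreorder par)
    (horder : ∀ v u, u ∈ order v ↔ ParAdj par (num v) (num u))
    (hsort : ∀ v, (order v).Pairwise (fun a b => num a < num b)) (v : V) :
    ∃ e, (num v : ℕ) < e ∧ e ≤ n ∧
      (∀ k, (num v : ℕ) < k → k < e → (num v : ℕ) ≤ par k ∧ par k < k) ∧
      (e < n → par e < num v ∨ e ≤ par e) ∧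
      Loop order (order v) (firstVertices num (num v + 1)) (firstVertices num e) := by
  induction hN : n - (num v : ℕ) using Nat.strong_induction_on generalizing v with
  | _ N ih =>
    obtain ⟨e, h1, h2, h3, h4⟩ := IsPreorder.exists_end (par := par) n (num v) (num v).2
    refine ⟨e, h1, h2, h3, h4, ?_⟩
    refine loop_children hpar h1 h3 h2 h4 (fun u hu => ih _ ?_ u rfl) (order v) _
      (hsort v) (Nat.lt_succ_self _) ?_ ?_ ?_
    · have := (num u).2
      have : (num v : ℕ) < num u := hu
      omega
    · rcases Nat.lt_or_ge (num v + 1) e with h | h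
      · have := h3 (num v + 1) (by omega) h
        omega
      · omega
    · intro u hu
      obtain ⟨hne, h⟩ := (horder v u).1 hu
      have := hpar.le (num u)
      have := hpar.le (num v)
      omega
    · intro u hu hp
      exact (horder v u).2 ⟨by omega, Or.inr hp⟩

/-- The outer loop behaves like the loop over the children of a virtual vertex: the subtrees of the
roots tile all the numbers, and `k` always stands at a root or at `n`. -/
theorem loop_roots (hpar : IsPreorder par)
    (horder : ∀ v u, u ∈ order v ↔ ParAdj par (num v) (num u))
    (hsort : ∀ v, (order v).Pairwise (fun a b => num a < num b)) :
    ∀ (l : List V) (k : ℕ), l.Pairwise (fun a b => num a < num b) → k ≤ n →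
      (k < n → k ≤ par k) → (∀ u, k ≤ num u → u ∈ l) →
      Loop order l (firstVertices num k) (firstVertices num n) := by
  intro l
  induction l with
  | nil =>
    intro k _ hk _ hall
    rcases hk.eq_or_lt with rfl | hk
    · exact Loop.nil _
    · have := hall (num.symm ⟨k, hk⟩) (by simp)
      simp at this
  | cons u l ihl =>
    intro k hl hkn hk hall
    rw [List.pairwise_cons] at hl
    rcases lt_or_ge (num u : ℕ) k with huk | huk
    · refine Loop.skip ((mem_firstVertices num k u).2 huk) (ihl k hl.2 hkn hk fun w hw => ?_)
      rcases List.mem_cons.1 (hall w hw) with rfl | h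
      · omega
      · exact h
    · have hku : k = num u := by
        have hkn' : k < n := by omega
        rcases List.mem_cons.1 (hall (num.symm ⟨k, hkn'⟩) (by simp)) with h | h
        · rw [← h]; simp
        · have := hl.1 _ h
          simp only [Equiv.apply_symm_apply, Fin.lt_def] at this
          omega
      subst hku
      obtain ⟨e, h1, h2, h3, h4, h5⟩ := exists_loop_subtree hpar horder hsort u
      refine Loop.visit (s' := firstVertices num e) (by simp [mem_firstVertices])
        (by rw [firstVertices_succ]; exact h5) (ihl e hl.2 h2 (fun he => ?_) fun w hw => ?_)
      · refine (h4 he).resolve_left fun h => ?_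
        have := hpar.nested e (num u) h h1
        have := hk (num u).2
        omega
      · rcases List.mem_cons.1 (hall w (by omega)) with rfl | h
        · omega
        · exact h

end Preorder

theorem IsPreorder.isDFSNumbering {n : ℕ} {V : Type*} {num : V ≃ Fin n} {par : ℕ → ℕ}
    (hpar : IsPreorder par) {G : SimpleGraph V}
    (hG : ∀ u v, G.Adj u v ↔ ParAdj par (num u) (num v)) : IsDFSNumbering G num := by
  have hsort : ((List.finRange n).map num.symm).Pairwise (fun a b => num a < num b) := by
    rw [List.pairwise_map]
    simpa using List.pairwise_lt_finRange n
  have hmem : ∀ v, v ∈ (List.finRange n).map num.symm := fun v => by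
    rw [List.mem_map]
    exact ⟨num v, List.mem_finRange _, by simp⟩
  have hne : ∀ {a b : V}, num a < num b → a ≠ b := fun h hab => by simp [hab] at h
  refine ⟨(List.finRange n).map num.symm, fun v => ((List.finRange n).map num.symm).filter
    fun u => decide (ParAdj par (num v) (num u)), firstVertices num n, ⟨hsort.imp hne, hmem⟩,
    fun v => ⟨(hsort.filter _).imp hne, fun u => ?_⟩, ?_,
    fun v => getElem?_firstVertices num n v (num v).2⟩
  · rw [List.mem_filter, decide_eq_true_iff, hG]
    exact and_iff_right (hmem u)
  · refine loop_roots (k := 0) hpar (fun v u => ?_) (fun v => hsort.filter _) _ hsort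
      (Nat.zero_le _) (fun _ => Nat.zero_le _) (fun u _ => hmem u)
    rw [List.mem_filter, decide_eq_true_iff]
    exact and_iff_right (hmem u)

/-! ### Blocks -/

/-- The parent function on a block of `7 * L` numbers. The numbers below `4 * L` form a path. The
interval `[4 * L, 5 * L)` continues this path if `y` holds, and consists of leaves attached to
`[0, L)` in reverse order otherwise; in the former case the leaves attached to `[0, L)` are in
`[6 * L, 7 * L)`. The numbers in `[5 * L, 6 * L)` are leaves attached to `[2 * L, 3 * L)` in reverse
order if `z` holds. All other numbers are roots. -/
def blockPar (L : ℕ) (y z : Bool) (r : ℕ) : ℕ :=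
  if r < 4 * L then r - 1
  else if r < 5 * L then (if y then r - 1 else 5 * L - 1 - r)
  else if r < 6 * L then (if z then 8 * L - 1 - r else r)
  else (if y then 7 * L - 1 - r else r)

/-- The numbers in a block whose neighborhood depends on the first parameter. -/
def InFirstHalf (L r : ℕ) : Prop := r < L ∨ 4 * L - 1 ≤ r ∧ r < 5 * L ∨ 6 * L ≤ r

/-- The numbers in a block whose neighborhood depends on the second parameter. -/
def InSecondHalf (L r : ℕ) : Prop := 2 * L ≤ r ∧ r < 3 * L ∨ 5 * L ≤ r ∧ r < 6 * L

/-- A potential that separates the two halves of a block and varies slowly along its edges. -/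
def blockHeight (L r : ℕ) : ℕ :=
  if 5 * L ≤ r ∧ r < 6 * L then L else min L (min (r + 1 - L) (4 * L - 1 - r))

theorem InFirstHalf.blockHeight_eq {L r : ℕ} (h : InFirstHalf L r) : blockHeight L r = 0 := by
  unfold InFirstHalf at h
  unfold blockHeight
  split_ifs <;> omega

theorem InSecondHalf.blockHeight_eq {L r : ℕ} (h : InSecondHalf L r) : blockHeight L r = L := by
  unfold InSecondHalf at h
  unfold blockHeight
  split_ifs <;> omega

theorem blockPar_le (L : ℕ) (y z : Bool) (r : ℕ) : blockPar L y z r ≤ r := by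
  unfold blockPar
  split_ifs <;> omega

/-- Equal parameters are essential. If both hold, the path fills `[0, 5 * L)` and later leaves hang
ever closer to its start, first on `[2 * L, 3 * L)`, then on `[0, L)`. If both fail, only the leaves
on `[0, L)` remain, followed by roots. -/
theorem blockPar_nested {L : ℕ} {y : Bool} {v w : ℕ} (hv : v < 7 * L)
    (h : blockPar L y y v < w) (hw : w < v) :
    blockPar L y y v ≤ blockPar L y y w ∧ blockPar L y y w < w := by
  unfold blockPar at *
  cases y <;> simp only [Bool.false_eq_true, if_false, if_true] at * <;> split_ifs at * <;> omega

/-- Only edges with both ends in the first half depend on `y`; `4 * L - 1` belongs to that half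
because its edge to `4 * L` exists only if `y` holds. -/
theorem blockPar_congr_left {L : ℕ} {y z : Bool} (y' : Bool) {u v : ℕ} (hu : u < 7 * L)
    (h : blockPar L y z u = v) (_hne : u ≠ v) (hy : y = y' ∨ ¬ InFirstHalf L u ∨ ¬ InFirstHalf L v) :
    blockPar L y' z u = v := by
  rcases eq_or_ne y y' with rfl | hyy
  · exact h
  replace hy := hy.resolve_left hyy
  unfold InFirstHalf at hy
  unfold blockPar at *
  split_ifs at * <;> first | exact h | (clear hyy; omega)

theorem blockPar_congr_right {L : ℕ} {y z : Bool} (z' : Bool) {u v : ℕ} (hu : u < 7 * L)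
    (h : blockPar L y z u = v) (_hne : u ≠ v)
    (hz : z = z' ∨ ¬ InSecondHalf L u ∨ ¬ InSecondHalf L v) : blockPar L y z' u = v := by
  rcases eq_or_ne z z' with rfl | hzz
  · exact h
  replace hz := hz.resolve_left hzz
  unfold InSecondHalf at hz
  unfold blockPar at *
  split_ifs at * <;> first | exact h | (clear hzz; omega)

theorem ParAdj.congr {L : ℕ} {y z y' z' : Bool} {r t : ℕ} (hr : r < 7 * L) (ht : t < 7 * L)
    (h1 : InFirstHalf L r → y = y') (h2 : InSecondHalf L r → z = z')
    (h : ParAdj (blockPar L y z) r t) : ParAdj (blockPar L y' z') r t := by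
  refine ⟨h.1, h.2.imp (fun h' => ?_) fun h' => ?_⟩
  · exact blockPar_congr_right z' hr (blockPar_congr_left y' hr h' h.1 (by tauto)) h.1 (by tauto)
  · exact blockPar_congr_right z' ht (blockPar_congr_left y' ht h' h.1.symm (by tauto)) h.1.symm
      (by tauto)

/-- The height climbs from `0` to `L` along the path on `[L, 2 * L)` and descends along `[3 * L, 4 *
L)`, by one per edge; leaves have the height of the part they hang on. -/
theorem blockHeight_blockPar {L : ℕ} {y z : Bool} {u : ℕ} (hu : u < 7 * L)
    (_hne : blockPar L y z u ≠ u) : blockHeight L u ≤ blockHeight L (blockPar L y z u) + 1 ∧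
      blockHeight L (blockPar L y z u) ≤ blockHeight L u + 1 := by
  obtain ⟨v, hv⟩ : ∃ v, blockPar L y z u = v := ⟨_, rfl⟩
  rw [hv] at _hne ⊢
  unfold blockPar at hv
  unfold blockHeight
  split_ifs at hv <;> split_ifs <;> omega

theorem ParAdj.blockHeight_le {L : ℕ} {y z : Bool} {r t : ℕ} (hr : r < 7 * L) (ht : t < 7 * L)
    (h : ParAdj (blockPar L y z) r t) : blockHeight L r ≤ blockHeight L t + 1 := by
  rcases h with ⟨hne, h | h⟩
  · have := blockHeight_blockPar (y := y) (z := z) hr (by omega)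
    rw [h] at this
    exact this.1
  · have := blockHeight_blockPar (y := y) (z := z) ht (by omega)
    rw [h] at this
    exact this.2

theorem ParAdj.eq_or_eq_or_eq {L : ℕ} {y z : Bool} {r t : ℕ} (hr : r < 7 * L) (ht : t < 7 * L)
    (h : ParAdj (blockPar L y z) r t) : t = blockPar L y z r ∨ t = r + 1 ∨
      t = if r < L then (if y then 7 * L - 1 - r else 5 * L - 1 - r) else 8 * L - 1 - r := by
  rcases h with ⟨hne, h | h⟩
  · exact Or.inl h.symm
  · right
    unfold blockPar at h
    cases y <;> cases z <;> simp only [Bool.false_eq_true, if_false, if_true] at * <;>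
      split_ifs at * <;> omega

/-! ### Sequences of blocks -/

/-- The parent function of a sequence of blocks with parameters `y` and `z`. -/
def chainPar (L : ℕ) (y z : ℕ → Bool) (u : ℕ) : ℕ :=
  7 * L * (u / (7 * L)) + blockPar L (y (u / (7 * L))) (z (u / (7 * L))) (u % (7 * L))

variable {L : ℕ} {y z : ℕ → Bool}

theorem chainPar_div (hL : 0 < L) (u : ℕ) : chainPar L y z u / (7 * L) = u / (7 * L) := by
  have h := Nat.mod_lt u (show 0 < 7 * L by omega)
  rw [chainPar, Nat.mul_add_div (by omega),
    Nat.div_eq_of_lt ((blockPar_le _ _ _ (u % (7 * L))).trans_lt h), add_zero]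

theorem chainPar_mod (hL : 0 < L) (u : ℕ) : chainPar L y z u % (7 * L) =
    blockPar L (y (u / (7 * L))) (z (u / (7 * L))) (u % (7 * L)) := by
  have h := Nat.mod_lt u (show 0 < 7 * L by omega)
  rw [chainPar, Nat.mul_add_mod, Nat.mod_eq_of_lt]
  exact (blockPar_le _ _ _ _).trans_lt h

theorem eq_iff_div_mod (a u v : ℕ) : u = v ↔ u / a = v / a ∧ u % a = v % a := by
  refine ⟨by rintro rfl; exact ⟨rfl, rfl⟩, fun ⟨h1, h2⟩ => ?_⟩
  rw [← Nat.div_add_mod u a, h1, h2, Nat.div_add_mod]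

theorem parAdj_chainPar (hL : 0 < L) (u v : ℕ) : ParAdj (chainPar L y z) u v ↔
    u / (7 * L) = v / (7 * L) ∧
      ParAdj (blockPar L (y (u / (7 * L))) (z (u / (7 * L)))) (u % (7 * L)) (v % (7 * L)) := by
  unfold ParAdj
  rw [ne_eq, eq_iff_div_mod (7 * L) u v, eq_iff_div_mod (7 * L) (chainPar L y z u),
    eq_iff_div_mod (7 * L) (chainPar L y z v), chainPar_div hL, chainPar_div hL, chainPar_mod hL,
    chainPar_mod hL]
  constructor
  · rintro ⟨h1, h2⟩
    have h3 : u / (7 * L) = v / (7 * L) := h2.elim (fun h => h.1) fun h => h.1.symm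
    rw [← h3] at h1 h2
    exact ⟨h3, by tauto, by tauto⟩
  · rintro ⟨h1, h2⟩
    rw [← h1]
    exact ⟨by tauto, by tauto⟩

theorem isPreorder_chainPar (hL : 0 < L) : IsPreorder (chainPar L y y) where
  le v := by
    have := blockPar_le L (y (v / (7 * L))) (y (v / (7 * L))) (v % (7 * L))
    have := Nat.div_add_mod v (7 * L)
    unfold chainPar
    omega
  nested v w h hw := by
    have h1 : w / (7 * L) = v / (7 * L) := by
      apply le_antisymm (Nat.div_le_div_right hw.le)
      rw [← chainPar_div (y := y) (z := y) hL v]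
      exact Nat.div_le_div_right h.le
    have hv' := Nat.mod_lt v (show 0 < 7 * L by omega)
    have hv := Nat.div_add_mod v (7 * L)
    have hw' := Nat.div_add_mod w (7 * L)
    unfold chainPar at h ⊢
    rw [h1] at hw' ⊢
    have := blockPar_nested (L := L) (y := y (v / (7 * L))) (w := w % (7 * L)) hv'
      (by omega) (by omega)
    omega

theorem card_parAdj_chainPar (hL : 0 < L) (u : ℕ) :
    ∃ S : Finset ℕ, S.card ≤ 3 ∧ ∀ v, ParAdj (chainPar L y z) u v → v ∈ S := by
  refine ⟨Finset.image (fun t => 7 * L * (u / (7 * L)) + t) {blockPar L (y (u / (7 * L)))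
    (z (u / (7 * L))) (u % (7 * L)), u % (7 * L) + 1, if u % (7 * L) < L then
      (if y (u / (7 * L)) then 7 * L - 1 - u % (7 * L) else 5 * L - 1 - u % (7 * L))
      else 8 * L - 1 - u % (7 * L)}, Finset.card_image_le.trans Finset.card_le_three,
    fun v hv => ?_⟩
  rw [parAdj_chainPar hL] at hv
  have h := hv.2.eq_or_eq_or_eq (Nat.mod_lt _ (by omega)) (Nat.mod_lt _ (by omega))
  rw [Finset.mem_image]
  refine ⟨v % (7 * L), by simpa only [Finset.mem_insert, Finset.mem_singleton] using h, ?_⟩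
  rw [hv.1, Nat.div_add_mod]

/-! ### Labeled forests -/

/-- The list of the neighbors of a number in a forest on `Fin n`. -/
def neighborList (n : ℕ) (par : ℕ → ℕ) (u : Fin n) : List (Fin n) :=
  (List.finRange n).filter fun v : Fin n => decide (ParAdj par u v)

theorem mem_neighborList {n : ℕ} {par : ℕ → ℕ} {u v : Fin n} :
    v ∈ neighborList n par u ↔ ParAdj par u v := by
  simp [neighborList]

/-- The forest with a given parent function on the labels, as an input of the bounded-degree
model. -/
def labeledForest {n d : ℕ} (par : ℕ → ℕ) (hd : 3 ≤ d)
    (hpar : ∀ u, ∃ S : Finset ℕ, S.card ≤ 3 ∧ ∀ v, ParAdj par u v → v ∈ S) (π : Fin n ≃ Fin n) :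
    LabeledGraph n d where
  graph :=
    { Adj := fun u v => ParAdj par (π u) (π v)
      symm := ⟨fun _ _ h => h.symm⟩
      loopless := ⟨fun _ h => h.1 rfl⟩ }
  adj v := (neighborList n par (π v)).map π.symm
  mem_adj v u := by
    rw [List.mem_map]
    constructor
    · rintro ⟨w, hw, rfl⟩
      simpa using mem_neighborList.1 hw
    · exact fun h => ⟨π u, mem_neighborList.2 h, by simp⟩
  nodup_adj v := ((List.nodup_finRange n).filter _).map π.symm.injective
  length_adj_le v := by
    obtain ⟨S, hS, h⟩ := hpar (π v)
    refine le_trans ?_ (hS.trans hd)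
    have hnd : ((neighborList n par (π v)).map Fin.val).Nodup :=
      ((List.nodup_finRange n).filter _).map Fin.val_injective
    rw [List.length_map, ← List.length_map (f := Fin.val), ← List.toFinset_card_of_nodup hnd]
    refine Finset.card_le_card fun u hu => ?_
    rw [List.mem_toFinset, List.mem_map] at hu
    obtain ⟨w, hw, rfl⟩ := hu
    exact h _ (mem_neighborList.1 hw)
  label := π

/-! ### Distance from having a DFS numbering -/

/-- A block with parameters `false` and `true` has many violations. -/
theorem exists_mem_symmDiff {n : ℕ} {G G' : SimpleGraph (Fin n)} {π : Fin n ≃ Fin n}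
    (hL : 0 < L) (hG : ∀ u v, G.Adj u v ↔ ParAdj (chainPar L y z) (π u) (π v))
    (hG' : IsDFSNumbering G' π) {b : ℕ} (hb : 7 * L * b + 7 * L ≤ n) (hy : y b = false)
    (hz : z b = true) :
    ∃ t, 4 * L ≤ t ∧ t + L ≤ 7 * L ∧ t % L = 0 ∧ ∀ k < L, ∃ v w, s(v, w) ∈ G.edgeSet ∆ G'.edgeSet ∧
      π w < π v ∧ (π v : ℕ) = 7 * L * b + (t + k) := by
  have hadj : ∀ {r t : ℕ} {u v : Fin n}, (π u : ℕ) = 7 * L * b + r → (π v : ℕ) = 7 * L * b + t →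
      r < 7 * L → t < 7 * L → (G.Adj u v ↔ ParAdj (blockPar L false true) r t) := by
    intro r t u v hu hv hr ht
    rw [hG, parAdj_chainPar hL, hu, hv, Nat.mul_add_div (by omega), Nat.mul_add_div (by omega),
      Nat.mul_add_mod, Nat.mul_add_mod, Nat.div_eq_of_lt hr, Nat.div_eq_of_lt ht,
      Nat.mod_eq_of_lt hr, Nat.mod_eq_of_lt ht, add_zero, hy, hz]
    simp
  let vtx : ∀ r, r < 7 * L → Fin n := fun r hr => π.symm ⟨7 * L * b + r, by omega⟩
  have hvtx : ∀ r hr, (π (vtx r hr) : ℕ) = 7 * L * b + r := fun r hr => by simp [vtx]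
  -- One surviving `z`-edge encloses all of `[4 * L, 5 * L)`. Each number there then needs an
  -- earlier neighbor that is at least `2 * L`, whereas in `G` its only earlier neighbor is below
  -- `L`: this gives `L` inserted edges.
  by_cases hex : ∃ k, ∃ hk : k < L, G'.Adj (vtx (3 * L - 1 - k) (by omega))
    (vtx (5 * L + k) (by omega))
  · obtain ⟨k₀, hk₀, hadj₀⟩ := hex
    refine ⟨4 * L, le_rfl, by omega, by simp, fun k hk => ?_⟩
    have h1 := hvtx (3 * L - 1 - k₀) (by omega)
    have h2 := hvtx (5 * L + k₀) (by omega)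
    have h3 := hvtx (4 * L + k) (by omega)
    obtain ⟨w, hw, hw1, hw2⟩ := hG'.exists_adj (b := vtx (4 * L + k) (by omega)) hadj₀
      (by rw [Fin.lt_def]; omega) (by rw [Fin.lt_def]; omega)
    refine ⟨vtx (4 * L + k) (by omega), w, ?_, hw2, h3⟩
    rw [Set.mem_symmDiff, SimpleGraph.mem_edgeSet, SimpleGraph.mem_edgeSet]
    refine Or.inr ⟨hw.symm, fun h => ?_⟩
    rw [Fin.lt_def] at hw2
    rw [Fin.le_def] at hw1
    obtain ⟨r, hr⟩ : ∃ r, (π w : ℕ) = 7 * L * b + r :=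
      ⟨π w - 7 * L * b, by omega⟩
    rw [hadj h3 hr (by omega) (by omega)] at h
    have := blockPar_le L false true r
    have h4 : blockPar L false true (4 * L + k) = 5 * L - 1 - (4 * L + k) := by
      unfold blockPar
      rw [if_neg (by omega), if_pos (by omega)]
      simp
    unfold ParAdj at h
    omega
  -- No `z`-edge survives, so all `L` of them were deleted.
  · push Not at hex
    refine ⟨5 * L, by omega, by omega, by simp, fun k hk => ?_⟩
    have h1 := hvtx (3 * L - 1 - k) (by omega)
    have h2 := hvtx (5 * L + k) (by omega)
    refine ⟨vtx (5 * L + k) (by omega), vtx (3 * L - 1 - k) (by omega), ?_, ?_, h2⟩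
    · rw [Set.mem_symmDiff, SimpleGraph.mem_edgeSet, SimpleGraph.mem_edgeSet]
      refine Or.inl ⟨?_, fun h => hex k hk h.symm⟩
      rw [hadj h2 h1 (by omega) (by omega)]
      refine ⟨by omega, Or.inl ?_⟩
      unfold blockPar
      rw [if_neg (by omega), if_neg (by omega), if_pos (by omega)]
      simp only [if_true]
      omega
    · rw [Fin.lt_def]
      omega

theorem le_ncard_symmDiff {n m : ℕ} {G G' : SimpleGraph (Fin n)} {π : Fin n ≃ Fin n}
    (hL : 0 < L) (hG : ∀ u v, G.Adj u v ↔ ParAdj (chainPar L y z) (π u) (π v))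
    (hG' : IsDFSNumbering G' π) (hm : 14 * L * m ≤ n)
    (hyz : ∀ j < m, ∃ b, b / 2 = j ∧ y b = false ∧ z b = true) :
    m * L ≤ (G.edgeSet ∆ G'.edgeSet).ncard := by
  -- Each modified edge is charged to its larger label. Division by `14 * L` recovers the pair of
  -- blocks and the remainder modulo `L` recovers `k`, as `t` and the block start are multiples of
  -- `L`; so the chosen edges are distinct.
  have key : ∀ i : Fin m × Fin L, ∃ e : Sym2 (Fin n), e ∈ G.edgeSet ∆ G'.edgeSet ∧
      ((e.map π).sup : ℕ) / (14 * L) = i.1 ∧ ((e.map π).sup : ℕ) % L = i.2 := by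
    rintro ⟨j, k⟩
    obtain ⟨b, hbj, hy, hz⟩ := hyz j j.2
    have hb : 14 * L * (j + 1) ≤ n :=
      (Nat.mul_le_mul_left _ (show (j : ℕ) + 1 ≤ m from j.2)).trans hm
    obtain ⟨p, hp, hbp⟩ : ∃ p, p < 2 ∧ b = 2 * j + p := ⟨b % 2, Nat.mod_lt _ two_pos, by omega⟩
    have hLb : 7 * L * b = 14 * L * j + 7 * L * p := by rw [hbp]; ring
    have hLp : 7 * L * p ≤ 7 * L := by
      calc 7 * L * p ≤ 7 * L * 1 := Nat.mul_le_mul_left _ (by omega)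
        _ = 7 * L := mul_one _
    obtain ⟨t, ht1, ht2, ht3, h⟩ := exists_mem_symmDiff hL hG hG' (b := b)
      (by rw [mul_add] at hb; omega) hy hz
    obtain ⟨v, w, he, hlt, hv⟩ := h k k.2
    have hk := k.2
    have hsup : ((Sym2.map π s(v, w)).sup : ℕ) = π v := by
      rw [Sym2.map_mk, Sym2.sup_mk, sup_eq_left.2 hlt.le]
    refine ⟨s(v, w), he, ?_, ?_⟩
    · rw [hsup, hv, hLb, add_assoc, Nat.mul_add_div (by omega), Nat.div_eq_of_lt (by omega),
        add_zero]
    · obtain ⟨t', rfl⟩ := Nat.dvd_of_mod_eq_zero ht3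
      rw [hsup, hv, show 7 * L * b + (L * t' + k) = L * (7 * b + t') + k by ring,
        Nat.mul_add_mod, Nat.mod_eq_of_lt hk]
  choose f hf1 hf2 hf3 using key
  have hinj : Function.Injective f := fun i i' h => by
    have h1 := hf2 i
    have h2 := hf3 i
    rw [h] at h1 h2
    exact Prod.ext (Fin.ext (h1.symm.trans (hf2 i'))) (Fin.ext (h2.symm.trans (hf3 i')))
  have := Set.ncard_le_ncard (Set.range_subset_iff.2 hf1) (Set.toFinite _)
  rw [← Set.image_univ, Set.ncard_image_of_injective _ hinj, Set.ncard_univ, Nat.card_prod,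
    Nat.card_fin, Nat.card_fin] at this
  exact this

/-! ### Queried vertices -/

/-- The vertices about which a query algorithm asks on a given input. -/
def QueryAlg.queried {n d : ℕ} (I : LabeledGraph n d) : QueryAlg n d → Finset (Fin n)
  | .output _ => ∅
  | .neighborQuery v i next => insert v ((next (I.adj v)[(i : ℕ)]?).queried I)
  | .labelQuery v next => insert v ((next (I.label v)).queried I)

/-- Agreement is needed only on the vertices queried on `I`: equal answers keep an adaptive
algorithm on the same computation path. -/
theorem QueryAlg.run_congr {n d : ℕ} {I I' : LabeledGraph n d} (T : QueryAlg n d)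
    (h : ∀ v ∈ T.queried I, I.adj v = I'.adj v ∧ I.label v = I'.label v) :
    T.run I = T.run I' ∧ T.queried I = T.queried I' := by
  induction T with
  | output b => exact ⟨rfl, rfl⟩
  | neighborQuery v i next ih =>
    simp only [queried, run] at h ⊢
    have hv := (h v (Finset.mem_insert_self _ _)).1
    have := ih _ fun w hw => h w (Finset.mem_insert_of_mem hw)
    rw [hv] at this ⊢
    exact ⟨this.1, by rw [this.2]⟩
  | labelQuery v next ih =>
    simp only [queried, run] at h ⊢
    have hv := (h v (Finset.mem_insert_self _ _)).2
    have := ih _ fun w hw => h w (Finset.mem_insert_of_mem hw)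
    rw [hv] at this ⊢
    exact ⟨this.1, by rw [this.2]⟩

/-! ### Random labelings -/

section RandomLabeling

variable {n d : ℕ}

open scoped Classical in
/-- The bijections that agree with `π₀` on `K`. -/
noncomputable def agreeing (π₀ : Equiv.Perm (Fin n)) (K : Finset (Fin n)) :
    Finset (Equiv.Perm (Fin n)) :=
  Finset.univ.filter fun π => ∀ v ∈ K, π v = π₀ v

theorem mem_agreeing {π₀ π : Equiv.Perm (Fin n)} {K : Finset (Fin n)} :
    π ∈ agreeing π₀ K ↔ ∀ v ∈ K, π v = π₀ v := by
  simp [agreeing]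

/-- The label of a vertex outside of `K` is uniformly distributed on the unused labels. -/
theorem card_agreeing_filter_le (π₀ : Equiv.Perm (Fin n)) {K : Finset (Fin n)} {v : Fin n}
    (hv : v ∉ K) (F : Finset (Fin n)) :
    ((agreeing π₀ K).filter fun π => π v ∈ F).card * (n - K.card) ≤
      F.card * (agreeing π₀ K).card := by
  classical
  set C := agreeing π₀ K
  let N : Fin n → ℕ := fun a => (C.filter fun π => π v = a).card
  have hle : ∀ a b, b ∉ K.image π₀ → N a ≤ N b := by
    intro a b hb
    by_cases ha : a ∈ K.image π₀
    · have : N a = 0 := by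
        rw [Finset.card_eq_zero, Finset.filter_eq_empty_iff]
        intro π hπ hπv
        obtain ⟨w, hw, rfl⟩ := Finset.mem_image.1 ha
        rw [← mem_agreeing.1 hπ w hw] at hπv
        exact hv (π.injective hπv ▸ hw)
      omega
    -- Swapping two labels not used on `K` preserves agreement on `K`, so all unused labels are
    -- equally likely at `v`.
    · refine Finset.card_le_card_of_injOn (fun π => Equiv.swap a b * π) ?_
        (fun π _ π' _ h => mul_left_cancel h)
      intro π hπ
      rw [Finset.mem_coe, Finset.mem_filter] at hπ ⊢
      refine ⟨mem_agreeing.2 fun w hw => ?_, by simp [hπ.2]⟩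
      have hw' := Finset.mem_image_of_mem π₀ hw
      rw [Equiv.Perm.mul_apply, mem_agreeing.1 hπ.1 w hw]
      exact Equiv.swap_apply_of_ne_of_ne (fun h => ha (h ▸ hw')) fun h => hb (h ▸ hw')
  have hsum : ∀ F : Finset (Fin n), (C.filter fun π => π v ∈ F).card = ∑ a ∈ F, N a := by
    intro F
    rw [Finset.card_eq_sum_card_fiberwise (s := C.filter fun π => π v ∈ F) (f := fun π => π v)
      (t := F) (fun π hπ => (Finset.mem_filter.1 hπ).2)]
    refine Finset.sum_congr rfl fun a ha => ?_
    rw [Finset.filter_filter]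
    congr 1
    refine Finset.filter_congr fun π _ => ⟨fun h => h.2, fun h => ⟨h ▸ ha, h⟩⟩
  have hK : (Finset.univ \ K.image π₀).card = n - K.card := by
    rw [Finset.card_sdiff_of_subset (Finset.subset_univ _), Finset.card_univ, Fintype.card_fin,
      Finset.card_image_of_injective _ π₀.injective]
  rw [hsum F, Finset.sum_mul, ← smul_eq_mul F.card]
  refine Finset.sum_le_card_nsmul _ _ _ fun a _ => ?_
  calc N a * (n - K.card) = ∑ b ∈ Finset.univ \ K.image π₀, N a := by
        rw [Finset.sum_const, hK, smul_eq_mul, mul_comm]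
    _ ≤ ∑ b ∈ Finset.univ \ K.image π₀, N b :=
        Finset.sum_le_sum fun b hb => hle a b (Finset.mem_sdiff.1 hb).2
    _ = (C.filter fun π => π v ∈ Finset.univ \ K.image π₀).card := (hsum _).symm
    _ ≤ C.card := Finset.card_filter_le _ _

/-- If a bound holds on each fiber of `g`, it holds in total. -/
theorem card_filter_mul_le_of_fibers {α β : Type*} [DecidableEq β] (C : Finset α) (g : α → β)
    (p : α → Prop) [DecidablePred p] (M R : ℕ)
    (h : ∀ a ∈ C, ((C.filter fun b => g b = g a).filter p).card * M ≤
      R * (C.filter fun b => g b = g a).card) :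
    (C.filter p).card * M ≤ R * C.card := by
  rw [Finset.card_eq_sum_card_fiberwise (f := g) (t := C.image g) (s := C)
      (fun a ha => Finset.mem_image_of_mem g ha),
    Finset.card_eq_sum_card_fiberwise (f := g) (t := C.image g) (s := C.filter p)
      (fun a ha => Finset.mem_image_of_mem g (Finset.mem_filter.1 ha).1),
    Finset.sum_mul, Finset.mul_sum]
  refine Finset.sum_le_sum fun x hx => ?_
  obtain ⟨a, ha, rfl⟩ := Finset.mem_image.1 hx
  have := h a ha
  rwa [Finset.filter_filter, Finset.filter_congr (q := fun b => p b ∧ g b = g a)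
    (fun _ _ => and_comm), ← Finset.filter_filter] at this

/-- Two vertices in a set have labels in the same class, but of very different heights. -/
def Spread (cls ht : Fin n → ℕ) (q : ℕ) (π : Equiv.Perm (Fin n)) (W : Finset (Fin n)) : Prop :=
  ∃ a ∈ W, ∃ b ∈ W, cls (π a) = cls (π b) ∧ ht (π a) + q < ht (π b)

theorem Spread.mono {cls ht : Fin n → ℕ} {q : ℕ} {π : Equiv.Perm (Fin n)}
    {W W' : Finset (Fin n)} (h : Spread cls ht q π W) (hW : W ⊆ W') : Spread cls ht q π W' := by
  obtain ⟨a, ha, b, hb, h⟩ := h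
  exact ⟨a, hW ha, b, hW hb, h⟩

/-- What is known after `t` queries, none of which hit a known class by chance. -/
structure Knowledge (cls ht : Fin n → ℕ) (t : ℕ) (π : Equiv.Perm (Fin n))
    (K : Finset (Fin n)) : Prop where
  card_le : K.card ≤ 2 * t
  card_cls_le : (K.image fun v => cls (π v)).card ≤ t
  ht_le : ∀ a ∈ K, ∀ b ∈ K, cls (π a) = cls (π b) → ht (π b) ≤ ht (π a) + t

variable {cls ht : Fin n → ℕ} {nb : Fin n → List (Fin n)} {s q : ℕ}

/-- The vertices that are revealed by a query `v` with answer `o`. -/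
def revealed (K : Finset (Fin n)) (v : Fin n) (o : Option (Fin n)) : Finset (Fin n) :=
  insert v (K ∪ o.toFinset)

/-- If `v` is known, the answer lies within height `1` of it, so the spread of its class grows by at
most one. If the class of `v` is new, it contains only `v` and the answer. -/
theorem Knowledge.revealed {t : ℕ} {π : Equiv.Perm (Fin n)} {K : Finset (Fin n)}
    (h : Knowledge cls ht t π K)
    (hnb : ∀ a, ∀ b ∈ nb a, cls b = cls a ∧ ht b ≤ ht a + 1 ∧ ht a ≤ ht b + 1)
    {v : Fin n} (hv : v ∈ K ∨ cls (π v) ∉ K.image fun v => cls (π v)) {o : Option (Fin n)}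
    (ho : ∀ u ∈ o, π u ∈ nb (π v)) : Knowledge cls ht (t + 1) π (revealed K v o) := by
  classical
  have hcls : ∀ u ∈ o, cls (π u) = cls (π v) := fun u hu => (hnb _ _ (ho u hu)).1
  have hmem : ∀ u, u ∈ DFSTesting.revealed K v o ↔ u = v ∨ u ∈ K ∨ u ∈ o := by
    intro u
    simp [DFSTesting.revealed]
  refine ⟨?_, ?_, ?_⟩
  · have h1 : o.toFinset.card ≤ 1 := by cases o <;> simp
    have h2 := Finset.card_union_le K o.toFinset
    have h3 := Finset.card_insert_le v (K ∪ o.toFinset)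
    have := h.card_le
    unfold DFSTesting.revealed
    omega
  · refine le_trans (Finset.card_le_card (t := insert (cls (π v)) (K.image fun v => cls (π v)))
      fun c hc => ?_) ((Finset.card_insert_le _ _).trans (Nat.succ_le_succ h.card_cls_le))
    obtain ⟨u, hu, rfl⟩ := Finset.mem_image.1 hc
    rcases (hmem u).1 hu with rfl | hu | hu
    · exact Finset.mem_insert_self _ _
    · exact Finset.mem_insert_of_mem (Finset.mem_image_of_mem _ hu)
    · rw [hcls u hu]
      exact Finset.mem_insert_self _ _
  · have hKv : ∀ a ∈ K, cls (π a) = cls (π v) → v ∈ K := fun a ha hav =>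
      hv.resolve_right fun hn => hn (hav ▸ Finset.mem_image_of_mem _ ha)
    have hvK : ∀ a ∈ K, cls (π a) = cls (π v) →
        ht (π v) ≤ ht (π a) + t ∧ ht (π a) ≤ ht (π v) + t := fun a ha hav =>
      ⟨h.ht_le a ha v (hKv a ha hav) hav, h.ht_le v (hKv a ha hav) a ha hav.symm⟩
    intro a ha b hb hab
    rcases (hmem a).1 ha with h1 | h1 | h1 <;> rcases (hmem b).1 hb with h2 | h2 | h2
    · subst h1
      subst h2
      omega
    · subst h1
      have := hvK b h2 hab.symm
      omega
    · subst h1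
      have := hnb _ _ (ho b h2)
      omega
    · subst h2
      have := hvK a h1 hab
      omega
    · have := h.ht_le a h1 b h2 hab
      omega
    · have := hnb _ _ (ho b h2)
      have := hvK a h1 (hab.trans this.1)
      omega
    · subst h2
      have := hnb _ _ (ho a h1)
      omega
    · have := hnb _ _ (ho a h1)
      have := hvK b h2 (hab.symm.trans this.1)
      omega
    · have := Option.mem_unique h1 h2
      subst this
      omega

/-- One step of the bound for the probability of a spread set of queries. -/
theorem card_spread_step
    (hs : ∀ c, (Finset.univ.filter fun a => cls a = c).card ≤ s)
    (hnb : ∀ a, ∀ b ∈ nb a, cls b = cls a ∧ ht b ≤ ht a + 1 ∧ ht a ≤ ht b + 1)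
    {t r : ℕ} {π₀ : Equiv.Perm (Fin n)} {K : Finset (Fin n)} (hK : Knowledge cls ht t π₀ K)
    (htr : t + (r + 1) ≤ q) (v : Fin n) (ans : Equiv.Perm (Fin n) → Option (Fin n))
    (hans : ∀ π, ∀ u ∈ ans π, π u ∈ nb (π v))
    (hfib : ∀ π π', π' v = π v → (∀ u ∈ ans π, π' u = π u) → ans π' = ans π)
    (hval : ∀ π π', π' v = π v → ans π' = ans π → ∀ u ∈ ans π, π' u = π u)
    (p : Equiv.Perm (Fin n) → Prop) [DecidablePred p]
    (ih : ∀ π ∈ agreeing π₀ K, Knowledge cls ht (t + 1) π (revealed K v (ans π)) →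
      ((agreeing π (revealed K v (ans π))).filter p).card * (n - 2 * q) ≤
        r * (q * s) * (agreeing π (revealed K v (ans π))).card) :
    ((agreeing π₀ K).filter p).card * (n - 2 * q) ≤
      (r + 1) * (q * s) * (agreeing π₀ K).card := by
  classical
  set C := agreeing π₀ K
  set I := K.image fun v => cls (π₀ v) with hI
  let bad : Equiv.Perm (Fin n) → Prop := fun π => v ∉ K ∧ cls (π v) ∈ I
  -- Here `bad` is the chance hit: an unknown vertex is queried and lands in a known class. There
  -- are at most `q` known classes, of at most `s` labels each.
  have hIπ : ∀ π ∈ C, (K.image fun v => cls (π v)) = I := fun π hπ =>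
    Finset.image_congr fun w hw => by simp only [mem_agreeing.1 hπ w hw]
  have h1 : (C.filter bad).card * (n - 2 * q) ≤ q * s * C.card := by
    by_cases hv : v ∈ K
    · have : C.filter bad = ∅ := Finset.filter_eq_empty_iff.2 fun π _ h => h.1 hv
      simp [this]
    let F : Finset (Fin n) := Finset.univ.filter fun a => cls a ∈ I
    have hF : F.card ≤ q * s := by
      calc F.card ≤ I.card * s := by
            rw [Finset.card_eq_sum_card_fiberwise (s := F) (f := cls) (t := I)
              (fun a ha => (Finset.mem_filter.1 ha).2), ← smul_eq_mul]
            refine Finset.sum_le_card_nsmul _ _ _ fun c _ => le_trans ?_ (hs c)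
            exact Finset.card_le_card (Finset.filter_subset_filter _ (Finset.subset_univ _))
        _ ≤ q * s := Nat.mul_le_mul_right _ (hK.card_cls_le.trans (by omega))
    calc (C.filter bad).card * (n - 2 * q)
        ≤ (C.filter fun π => π v ∈ F).card * (n - K.card) := by
          refine Nat.mul_le_mul (Finset.card_le_card fun π hπ => ?_) ?_
          · rw [Finset.mem_filter] at hπ ⊢
            exact ⟨hπ.1, Finset.mem_filter.2 ⟨Finset.mem_univ _, hπ.2.2⟩⟩
          · have := hK.card_le
            omega
      _ ≤ F.card * C.card := card_agreeing_filter_le π₀ hv F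
      _ ≤ q * s * C.card := Nat.mul_le_mul_right _ hF
  have h2 : (C.filter fun π => p π ∧ ¬ bad π).card * (n - 2 * q) ≤ r * (q * s) * C.card := by
    refine card_filter_mul_le_of_fibers C (fun π => (π v, ans π)) _ _ _ fun π hπ => ?_
    -- Conditioning on the label of `v` and the answer again yields a uniform labeling with
    -- prescribed values, now on the enlarged set, so `ih` applies fiberwise. Moreover `bad` is
    -- constant on fibers.
    have hfiber : (C.filter fun π' => (π' v, ans π') = (π v, ans π)) =
        agreeing π (revealed K v (ans π)) := by
      ext π'
      rw [Finset.mem_filter, mem_agreeing, mem_agreeing, Prod.mk.injEq]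
      constructor
      · rintro ⟨h, hv, ha⟩ u hu
        simp only [revealed, Finset.mem_insert, Finset.mem_union, Option.mem_toFinset] at hu
        rcases hu with rfl | hu | hu
        · exact hv
        · rw [h u hu, mem_agreeing.1 hπ u hu]
        · exact hval π π' hv ha u hu
      · intro h
        simp only [revealed, Finset.mem_insert, Finset.mem_union, Option.mem_toFinset] at h
        refine ⟨fun u hu => ?_, h v (Or.inl rfl), hfib π π' (h v (Or.inl rfl)) fun u hu =>
          h u (Or.inr (Or.inr hu))⟩
        rw [h u (Or.inr (Or.inl hu)), mem_agreeing.1 hπ u hu]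
    by_cases hb : bad π
    · have : ((C.filter fun π' => (π' v, ans π') = (π v, ans π)).filter
          fun π => p π ∧ ¬ bad π) = ∅ := by
        rw [Finset.filter_eq_empty_iff]
        intro π' hπ' h
        have := (Prod.mk.injEq _ _ _ _ ▸ (Finset.mem_filter.1 hπ').2).1
        exact h.2 ⟨hb.1, by rw [this]; exact hb.2⟩
      rw [this]
      simp
    · have hKπ : Knowledge cls ht t π K := by
        refine ⟨hK.card_le, (hIπ π hπ).symm ▸ hK.card_cls_le, fun a ha b hb => ?_⟩
        rw [mem_agreeing.1 hπ a ha, mem_agreeing.1 hπ b hb]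
        exact hK.ht_le a ha b hb
      have hv : v ∈ K ∨ cls (π v) ∉ K.image fun v => cls (π v) := by
        rw [hIπ π hπ]
        exact or_iff_not_imp_left.2 fun h h' => hb ⟨h, h'⟩
      have := ih π hπ (hKπ.revealed hnb hv (hans π))
      rw [hfiber]
      refine le_trans (Nat.mul_le_mul_right _ (Finset.card_le_card fun π' hπ' => ?_)) this
      rw [Finset.mem_filter] at hπ' ⊢
      exact ⟨hπ'.1, hπ'.2.1⟩
  calc (C.filter p).card * (n - 2 * q)
      ≤ ((C.filter bad).card + (C.filter fun π => p π ∧ ¬ bad π).card) * (n - 2 * q) := by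
        refine Nat.mul_le_mul_right _ (le_trans (Finset.card_le_card fun π hπ => ?_)
          (Finset.card_union_le _ _))
        rw [Finset.mem_union, Finset.mem_filter, Finset.mem_filter]
        rw [Finset.mem_filter] at hπ
        by_cases hb : bad π
        · exact Or.inl ⟨hπ.1, hb⟩
        · exact Or.inr ⟨hπ.1, hπ.2, hb⟩
    _ ≤ (r + 1) * (q * s) * C.card := by
        rw [add_mul, add_mul (r : ℕ) 1, one_mul, add_mul (r * (q * s))]
        omega

theorem agreeing_revealed {π₀ π π' : Equiv.Perm (Fin n)} {K : Finset (Fin n)} {v : Fin n}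
    {o : Option (Fin n)} (hπ : π ∈ agreeing π₀ K) (hπ' : π' ∈ agreeing π (revealed K v o)) :
    π' ∈ agreeing π₀ K ∧ π' v = π v ∧ ∀ u ∈ o, π' u = π u := by
  rw [mem_agreeing] at *
  simp only [revealed, Finset.mem_insert, Finset.mem_union, Option.mem_toFinset] at hπ'
  exact ⟨fun u hu => (hπ' u (Or.inr (Or.inl hu))).trans (hπ u hu), hπ' v (Or.inl rfl),
    fun u hu => hπ' u (Or.inr (Or.inr hu))⟩

/-- Induction over the decision tree, with `t` queries made and `r` left; each remaining query
contributes one chance-hit term `q * s`. At a leaf, `Knowledge` with `t ≤ q` excludes `Spread`. -/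
theorem card_spread_le
    (hs : ∀ c, (Finset.univ.filter fun a => cls a = c).card ≤ s)
    (hnb : ∀ a, ∀ b ∈ nb a, cls b = cls a ∧ ht b ≤ ht a + 1 ∧ ht a ≤ ht b + 1)
    (I : Equiv.Perm (Fin n) → LabeledGraph n d) (hlabel : ∀ π v, (I π).label v = π v)
    (hadj : ∀ π v, (I π).adj v = (nb (π v)).map π.symm) (T : QueryAlg n d)
    (p : Equiv.Perm (Fin n) → Prop) [DecidablePred p] :
    ∀ (t r : ℕ) (π₀ : Equiv.Perm (Fin n)) (K : Finset (Fin n)), Knowledge cls ht t π₀ K →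
      t + r ≤ q → (∀ π ∈ agreeing π₀ K, T.numQueries (I π) ≤ r) →
      (∀ π ∈ agreeing π₀ K, p π → Spread cls ht q π (K ∪ T.queried (I π))) →
      ((agreeing π₀ K).filter p).card * (n - 2 * q) ≤ r * (q * s) * (agreeing π₀ K).card := by
  have hself : ∀ (π₀ : Equiv.Perm (Fin n)) (K : Finset (Fin n)), π₀ ∈ agreeing π₀ K :=
    fun π₀ K => mem_agreeing.2 fun _ _ => rfl
  induction T with
  | output b =>
    intro t r π₀ K hK htr hT hp
    have : (agreeing π₀ K).filter p = ∅ := by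
      rw [Finset.filter_eq_empty_iff]
      intro π hπ h
      obtain ⟨a, ha, b, hb, h1, h2⟩ := hp π hπ h
      simp only [QueryAlg.queried, Finset.union_empty] at ha hb
      rw [mem_agreeing.1 hπ a ha, mem_agreeing.1 hπ b hb] at h1 h2
      have := hK.ht_le a ha b hb h1
      omega
    rw [this]
    simp
  | neighborQuery v i next ih =>
    intro t r π₀ K hK htr hT hp
    simp only [QueryAlg.numQueries, QueryAlg.queried] at hT hp
    have hr := hT π₀ (hself _ _)
    obtain ⟨r, rfl⟩ : ∃ r', r = r' + 1 := Nat.exists_eq_add_one_of_ne_zero (by omega)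
    have hopt : ∀ π : Equiv.Perm (Fin n), ((I π).adj v)[(i : ℕ)]? =
        ((nb (π v))[(i : ℕ)]?).map π.symm := fun π => by rw [hadj, List.getElem?_map]
    have hmemans : ∀ π : Equiv.Perm (Fin n), ∀ u,
        u ∈ ((I π).adj v)[(i : ℕ)]? ↔ (nb (π v))[(i : ℕ)]? = some (π u) := by
      intro π u
      rw [hopt, Option.mem_def, Option.map_eq_some_iff]
      constructor
      · rintro ⟨a, ha, rfl⟩
        simpa using ha
      · exact fun h => ⟨_, h, by simp⟩
    have hfib : ∀ π π' : Equiv.Perm (Fin n), π' v = π v →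
        (∀ u ∈ ((I π).adj v)[(i : ℕ)]?, π' u = π u) →
        ((I π').adj v)[(i : ℕ)]? = ((I π).adj v)[(i : ℕ)]? := by
      intro π π' hv h
      rw [hopt] at h ⊢
      rw [hopt, hv]
      cases hnbv : (nb (π v))[(i : ℕ)]? with
      | none => rfl
      | some a =>
        have := h (π.symm a) (by simp [hnbv])
        rw [Equiv.apply_symm_apply] at this
        rw [Option.map_some, Option.map_some, ← this, Equiv.symm_apply_apply, this]
    refine card_spread_step hs hnb hK htr v (fun π => ((I π).adj v)[(i : ℕ)]?) ?_ hfib ?_ p ?_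
    · exact fun π u hu => List.mem_of_getElem? ((hmemans π u).1 hu)
    · intro π π' hv h u hu
      have h1 := (hmemans π u).1 hu
      rw [← h] at hu
      have h2 := (hmemans π' u).1 hu
      rw [hv, h1] at h2
      exact (Option.some.inj h2).symm
    · intro π hπ hKn
      refine ih (((I π).adj v)[(i : ℕ)]?) (t + 1) r π _ hKn (by omega) (fun π' hπ' => ?_)
        fun π' hπ' hpπ => ?_
      all_goals
        obtain ⟨h1, h2, h3⟩ := agreeing_revealed hπ hπ'
        have h4 := hfib π π' h2 h3
      · have := hT π' h1
        rw [h4] at this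
        omega
      · have := hp π' h1 hpπ
        rw [h4] at this
        exact this.mono (by intro u; simp only [revealed, Finset.mem_union, Finset.mem_insert]; tauto)
  | labelQuery v next ih =>
    intro t r π₀ K hK htr hT hp
    simp only [QueryAlg.numQueries, QueryAlg.queried, hlabel] at hT hp
    have hr := hT π₀ (hself _ _)
    obtain ⟨r, rfl⟩ : ∃ r', r = r' + 1 := Nat.exists_eq_add_one_of_ne_zero (by omega)
    refine card_spread_step hs hnb hK htr v (fun _ => none) (by simp) (by simp) (by simp) p ?_
    intro π hπ hKn
    refine ih (π v) (t + 1) r π _ hKn (by omega) (fun π' hπ' => ?_) fun π' hπ' hpπ => ?_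
    all_goals obtain ⟨h1, h2, -⟩ := agreeing_revealed hπ hπ'
    · have := hT π' h1
      rw [h2] at this
      omega
    · have := hp π' h1 hpπ
      rw [h2] at this
      exact this.mono (by intro u; simp only [revealed, Finset.mem_union, Finset.mem_insert]; tauto)

/-- It is unlikely that a query algorithm finds two vertices with labels in the same class and of
very different heights. -/
theorem card_spread_queried_le
    (hs : ∀ c, (Finset.univ.filter fun a => cls a = c).card ≤ s)
    (hnb : ∀ a, ∀ b ∈ nb a, cls b = cls a ∧ ht b ≤ ht a + 1 ∧ ht a ≤ ht b + 1)
    (I : Equiv.Perm (Fin n) → LabeledGraph n d) (hlabel : ∀ π v, (I π).label v = π v)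
    (hadj : ∀ π v, (I π).adj v = (nb (π v)).map π.symm) (T : QueryAlg n d)
    (hT : ∀ π, T.numQueries (I π) ≤ q) (p : Equiv.Perm (Fin n) → Prop) [DecidablePred p]
    (hp : ∀ π, p π → Spread cls ht q π (T.queried (I π))) :
    (Finset.univ.filter p).card * (n - 2 * q) ≤
      q * (q * s) * Fintype.card (Equiv.Perm (Fin n)) := by
  have huniv : agreeing (1 : Equiv.Perm (Fin n)) ∅ = Finset.univ := by
    ext π
    simp [mem_agreeing]
  have := card_spread_le (q := q) hs hnb I hlabel hadj T p 0 q 1 ∅ ⟨by simp, by simp, by simp⟩ (by omega)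
    (fun π _ => hT π) fun π _ h => by simpa using hp π h
  rwa [huniv, Finset.card_univ] at this

end RandomLabeling

/-! ### The hard inputs -/

section HardInputs

variable {L : ℕ} {y z : ℕ → Bool}

theorem neighborList_chainPar_congr {y' z' : ℕ → Bool} {n : ℕ} (hL : 0 < L) (u : Fin n)
    (h1 : InFirstHalf L (u % (7 * L)) → y (u / (7 * L)) = y' (u / (7 * L)))
    (h2 : InSecondHalf L (u % (7 * L)) → z (u / (7 * L)) = z' (u / (7 * L))) :
    neighborList n (chainPar L y z) u = neighborList n (chainPar L y' z') u := by
  refine List.filter_congr fun v _ => ?_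
  rw [decide_eq_decide, parAdj_chainPar hL, parAdj_chainPar hL]
  refine and_congr_right fun _ => ⟨fun h => h.congr (Nat.mod_lt _ (by omega))
    (Nat.mod_lt _ (by omega)) h1 h2, fun h => h.congr (Nat.mod_lt _ (by omega))
    (Nat.mod_lt _ (by omega)) (fun h => (h1 h).symm) fun h => (h2 h).symm⟩

theorem mem_neighborList_chainPar {n : ℕ} (hL : 0 < L) {u v : Fin n}
    (h : v ∈ neighborList n (chainPar L y z) u) :
    (v : ℕ) / (7 * L) / 2 = u / (7 * L) / 2 ∧
      blockHeight L (v % (7 * L)) ≤ blockHeight L (u % (7 * L)) + 1 ∧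
      blockHeight L (u % (7 * L)) ≤ blockHeight L (v % (7 * L)) + 1 := by
  rw [mem_neighborList, parAdj_chainPar hL] at h
  have hu := Nat.mod_lt (u : ℕ) (show 0 < 7 * L by omega)
  have hv := Nat.mod_lt (v : ℕ) (show 0 < 7 * L by omega)
  exact ⟨by rw [h.1], h.2.symm.blockHeight_le hv hu, h.2.blockHeight_le hu hv⟩

theorem card_filter_div_div_le (n c : ℕ) (hL : 0 < L) :
    (Finset.univ.filter fun u : Fin n => (u : ℕ) / (7 * L) / 2 = c).card ≤ 14 * L := by
  rw [← Finset.card_map Fin.valEmbedding]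
  refine (Finset.card_le_card (t := Finset.Ico (14 * L * c) (14 * L * c + 14 * L))
    fun u hu => ?_).trans_eq (by simp)
  obtain ⟨w, hw, rfl⟩ := Finset.mem_map.1 hu
  have h := (Finset.mem_filter.1 hw).2
  rw [Nat.div_div_eq_div_mul, show 7 * L * 2 = 14 * L by ring] at h
  rw [Finset.mem_Ico, Fin.valEmbedding_apply]
  have h1 := Nat.div_add_mod (w : ℕ) (14 * L)
  have h2 := Nat.mod_lt (w : ℕ) (show 0 < 14 * L by omega)
  rw [h] at h1
  omega

/-- The two blocks of a pair get opposite parameters, which depend on one bit of `x`. -/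
def pairBit {n : ℕ} (x : Fin n → Bool) (b : ℕ) : Bool :=
  -- The default is irrelevant for labels: a label below `n` has pair index below `n`.
  (if h : b / 2 < n then x ⟨b / 2, h⟩ else false) ^^ decide (b % 2 = 1)

theorem pairBit_xor {n : ℕ} (x J : Fin n → Bool) (b : ℕ) (h : b / 2 < n) :
    pairBit (fun j => x j ^^ J j) b = (pairBit x b ^^ J ⟨b / 2, h⟩) := by
  unfold pairBit
  rw [dif_pos h, dif_pos h, Bool.xor_right_comm]

theorem exists_pairBit_eq_false {n : ℕ} (x : Fin n → Bool) (j : ℕ) :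
    ∃ b, b / 2 = j ∧ pairBit x b = false := by
  by_cases h : pairBit x (2 * j) = false
  · exact ⟨2 * j, by omega, h⟩
  · refine ⟨2 * j + 1, by omega, ?_⟩
    unfold pairBit at *
    rw [show (2 * j + 1) / 2 = j by omega, show (2 * j + 1) % 2 = 1 by omega]
    rw [show 2 * j / 2 = j by omega, show 2 * j % 2 = 0 by omega] at h
    simpa using h

variable {n d : ℕ} (hL : 0 < L) (hd : 3 ≤ d)

/-- An input with a valid DFS numbering. -/
def nestedInput (ω : Equiv.Perm (Fin n) × (Fin n → Bool)) : LabeledGraph n d :=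
  labeledForest (chainPar L (pairBit ω.2) (pairBit ω.2)) hd (card_parAdj_chainPar hL) ω.1

/-- An input that is far from having a valid DFS numbering. -/
def crossedInput (ω : Equiv.Perm (Fin n) × (Fin n → Bool)) : LabeledGraph n d :=
  labeledForest (chainPar L (pairBit ω.2) fun b => !pairBit ω.2 b) hd (card_parAdj_chainPar hL) ω.1

theorem isDFSNumbering_nestedInput (ω : Equiv.Perm (Fin n) × (Fin n → Bool)) :
    IsDFSNumbering (nestedInput hL hd ω).graph (nestedInput hL hd ω).label :=
  (isPreorder_chainPar hL).isDFSNumbering fun _ _ => Iff.rfl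

theorem isFar_crossedInput (hn : 14 * L ≤ n) {ε : ℝ} (hε : ε ≤ 1 / 33)
    (ω : Equiv.Perm (Fin n) × (Fin n → Bool)) :
    IsFar d ε (crossedInput hL hd ω).graph (crossedInput hL hd ω).label := by
  intro G' _ hG'
  have h := le_ncard_symmDiff (G := (crossedInput hL hd ω).graph) (G' := G') (m := n / (14 * L)) hL
    (fun _ _ => Iff.rfl) hG' (Nat.mul_div_le _ _) fun j _ => by
      obtain ⟨b, hb, h⟩ := exists_pairBit_eq_false ω.2 j
      exact ⟨b, hb, h, by simp [h]⟩
  have h1 := Nat.div_add_mod n (14 * L)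
  have h2 := Nat.mod_lt n (show 0 < 14 * L by omega)
  -- With at least one full pair, the incomplete rest is shorter than the full pairs together, so
  -- `n` is less than `28` times the number of charged edges, within the required factor `33`.
  have h3 : 1 * L ≤ n / (14 * L) * L :=
    Nat.mul_le_mul_right _ ((Nat.one_le_div_iff (by omega)).2 hn)
  have h4 : 14 * L * (n / (14 * L)) = 14 * (n / (14 * L) * L) := by ring
  have h5 : n < 33 * ((crossedInput hL hd ω).graph.edgeSet ∆ G'.edgeSet).ncard := by omega
  have h6 : (n : ℝ) < 33 * (((crossedInput hL hd ω).graph.edgeSet ∆ G'.edgeSet).ncard : ℝ) := by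
    exact_mod_cast h5
  have h7 : ε * (n : ℝ) ≤ 1 / 33 * n := mul_le_mul_of_nonneg_right hε (Nat.cast_nonneg n)
  linarith

/-! ### Indistinguishability -/

open scoped Classical in
/-- The pairs of blocks such that a query hits a second half. -/
noncomputable def flips (T : QueryAlg n d) (ω : Equiv.Perm (Fin n) × (Fin n → Bool)) :
    Fin n → Bool := fun j => decide (∃ v ∈ T.queried (nestedInput hL hd ω),
  InSecondHalf L (ω.1 v % (7 * L)) ∧ (ω.1 v : ℕ) / (7 * L) / 2 = j)

/-- The queries on a nested input hit both halves of some pair of blocks. -/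
def HitsBoth (T : QueryAlg n d) (ω : Equiv.Perm (Fin n) × (Fin n → Bool)) : Prop :=
  ∃ v ∈ T.queried (nestedInput hL hd ω), ∃ w ∈ T.queried (nestedInput hL hd ω),
    (ω.1 v : ℕ) / (7 * L) / 2 = (ω.1 w : ℕ) / (7 * L) / 2 ∧
      InFirstHalf L (ω.1 v % (7 * L)) ∧ InSecondHalf L (ω.1 w % (7 * L))

open scoped Classical in
theorem flips_eq_true_iff {T : QueryAlg n d} {ω : Equiv.Perm (Fin n) × (Fin n → Bool)}
    {j : Fin n} : flips hL hd T ω j = true ↔ ∃ v ∈ T.queried (nestedInput hL hd ω),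
      InSecondHalf L (ω.1 v % (7 * L)) ∧ (ω.1 v : ℕ) / (7 * L) / 2 = j := by
  rw [flips, decide_eq_true_iff]

/-- Where a first half is seen, the bit is kept and so is `y`. Where a second half is seen, the flip
of the bit cancels the negation in the `z` of the crossed input. Other numbers have neighborhoods
independent of both parameters. -/
theorem adj_eq_of_not_hitsBoth {T : QueryAlg n d} {ω : Equiv.Perm (Fin n) × (Fin n → Bool)}
    (h : ¬ HitsBoth hL hd T ω) {v : Fin n} (hv : v ∈ T.queried (nestedInput hL hd ω)) :
    (nestedInput hL hd ω).adj v =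
      (crossedInput hL hd (ω.1, fun j => ω.2 j ^^ flips hL hd T ω j)).adj v := by
  have hlt : (ω.1 v : ℕ) / (7 * L) / 2 < n :=
    ((Nat.div_le_self _ _).trans (Nat.div_le_self _ _)).trans_lt (ω.1 v).2
  refine congrArg (List.map ω.1.symm) (neighborList_chainPar_congr hL (ω.1 v) ?_ ?_)
  · intro h1
    dsimp only
    have : flips hL hd T ω ⟨_, hlt⟩ = false := by
      rw [← Bool.not_eq_true, flips_eq_true_iff]
      rintro ⟨w, hw, hw2, hw3⟩
      exact h ⟨v, hv, w, hw, hw3.symm, h1, hw2⟩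
    rw [pairBit_xor _ _ _ hlt, this, Bool.xor_false]
  · intro h2
    dsimp only
    have : flips hL hd T ω ⟨_, hlt⟩ = true :=
      (flips_eq_true_iff hL hd).2 ⟨v, hv, h2, rfl⟩
    rw [pairBit_xor _ _ _ hlt, this, Bool.xor_true, Bool.not_not]

open scoped Classical in
-- Outside `HitsBoth`, the bit flip sends accepted nested inputs injectively to accepted crossed
-- ones, so acceptance counts differ by at most the number of exceptions.
theorem card_run_eq_le (T : QueryAlg n d) :
    (Finset.univ.filter fun ω => T.run (nestedInput (n := n) hL hd ω) = true).card +
      (Finset.univ.filter fun ω => T.run (crossedInput (n := n) hL hd ω) = false).card ≤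
    Fintype.card (Equiv.Perm (Fin n) × (Fin n → Bool)) +
      (Finset.univ.filter fun ω => HitsBoth (n := n) hL hd T ω).card := by
  have key : ∀ ω : Equiv.Perm (Fin n) × (Fin n → Bool), ¬ HitsBoth hL hd T ω →
      T.run (nestedInput hL hd ω) =
        T.run (crossedInput hL hd (ω.1, fun j => ω.2 j ^^ flips hL hd T ω j)) ∧
      T.queried (nestedInput hL hd ω) =
        T.queried (crossedInput hL hd (ω.1, fun j => ω.2 j ^^ flips hL hd T ω j)) :=
    fun ω h => T.run_congr fun v hv => ⟨adj_eq_of_not_hitsBoth hL hd h hv, rfl⟩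
  have h1 : (Finset.univ.filter fun ω =>
      T.run (nestedInput (n := n) hL hd ω) = true ∧ ¬ HitsBoth hL hd T ω).card ≤
      (Finset.univ.filter fun ω => T.run (crossedInput (n := n) hL hd ω) = true).card := by
    refine Finset.card_le_card_of_injOn
      (fun ω => (ω.1, fun j => ω.2 j ^^ flips hL hd T ω j)) ?_ ?_
    · intro ω hω
      rw [Finset.mem_coe, Finset.mem_filter] at hω ⊢
      exact ⟨Finset.mem_univ _, (key ω hω.2.2).1.symm.trans hω.2.1⟩
    · intro ω hω ω' hω' h
      rw [Finset.mem_coe, Finset.mem_filter] at hω hω'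
      -- The flip can be undone from its image: the crossed input determines the queried set, which
      -- together with the labeling determines `flips`.
      have hq := (key ω hω.2.2).2.trans ((congrArg (fun ω => T.queried (crossedInput hL hd ω)) h).trans
        (key ω' hω'.2.2).2.symm)
      obtain ⟨hπ, hx⟩ := Prod.mk.injEq _ _ _ _ ▸ h
      have hf : flips hL hd T ω = flips hL hd T ω' := by
        funext j
        unfold flips
        rw [hq, hπ]
      refine Prod.ext hπ (funext fun j => ?_)
      have := congrFun hx j
      simp only [hf] at this
      exact Bool.xor_left_inj.1 this
  have h2 : (Finset.univ.filter fun ω => T.run (nestedInput (n := n) hL hd ω) = true).card ≤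
      (Finset.univ.filter fun ω =>
        T.run (nestedInput (n := n) hL hd ω) = true ∧ ¬ HitsBoth hL hd T ω).card +
      (Finset.univ.filter fun ω => HitsBoth (n := n) hL hd T ω).card := by
    refine (Finset.card_le_card fun ω hω => ?_).trans (Finset.card_union_le _ _)
    rw [Finset.mem_filter] at hω
    rw [Finset.mem_union, Finset.mem_filter, Finset.mem_filter]
    by_cases hb : HitsBoth hL hd T ω
    · exact Or.inr ⟨hω.1, hb⟩
    · exact Or.inl ⟨hω.1, hω.2, hb⟩
  have h3 := Finset.card_filter_add_card_filter_not (s := Finset.univ)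
    fun ω => T.run (crossedInput (n := n) hL hd ω) = true
  simp only [Bool.not_eq_true, Finset.card_univ] at h3
  omega

open scoped Classical in
-- For fixed bits only the labeling is random. Classes are pairs of blocks, of size at most `14 *
-- L`, and the two halves have heights `0` and `L > q`, so hitting both is a spread.
theorem card_hitsBoth_le {q : ℕ} (hq : q < L) (T : QueryAlg n d)
    (hT : ∀ I : LabeledGraph n d, T.numQueries I ≤ q) :
    (Finset.univ.filter fun ω => HitsBoth (n := n) hL hd T ω).card * (n - 2 * q) ≤
      q * (q * (14 * L)) * Fintype.card (Equiv.Perm (Fin n) × (Fin n → Bool)) := by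
  have hx : ∀ x : Fin n → Bool,
      (Finset.univ.filter fun π => HitsBoth (n := n) hL hd T (π, x)).card * (n - 2 * q) ≤
        q * (q * (14 * L)) * Fintype.card (Equiv.Perm (Fin n)) := by
    intro x
    refine card_spread_queried_le (cls := fun u => (u : ℕ) / (7 * L) / 2)
      (ht := fun u => blockHeight L (u % (7 * L)))
      (nb := neighborList n (chainPar L (pairBit x) (pairBit x)))
      (fun c => card_filter_div_div_le n c hL) (fun a b h => mem_neighborList_chainPar hL h)
      (fun π => nestedInput hL hd (π, x)) (fun _ _ => rfl) (fun _ _ => rfl) T (fun _ => hT _) _ ?_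
    rintro π ⟨v, hv, w, hw, h1, h2, h3⟩
    refine ⟨v, hv, w, hw, h1, ?_⟩
    dsimp only
    rw [h2.blockHeight_eq, h3.blockHeight_eq]
    omega
  have hsum : (Finset.univ.filter fun ω => HitsBoth (n := n) hL hd T ω).card =
      ∑ x : Fin n → Bool,
        (Finset.univ.filter fun π => HitsBoth (n := n) hL hd T (π, x)).card := by
    simp only [Finset.card_filter]
    rw [Fintype.sum_prod_type_right]
  rw [hsum, Finset.sum_mul, Fintype.card_prod, ← mul_assoc, mul_comm _ (Fintype.card (Fin n → Bool)),
    ← Finset.card_univ (α := Fin n → Bool), ← smul_eq_mul (Finset.card _)]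
  exact Finset.sum_le_card_nsmul _ _ _ fun x _ => hx x

end HardInputs

/-! ### The lower bound -/

open scoped Classical in
theorem sum_outputProb {n d : ℕ} {Ω : Type*} [Fintype Ω] (A : PMF (QueryAlg n d))
    (I : Ω → LabeledGraph n d) (b : Bool) :
    ∑ ω, outputProb A (I ω) b =
      ∑' T, A T * ((Finset.univ.filter fun ω => T.run (I ω) = b).card : ENNReal) := by
  simp only [outputProb, PMF.map_apply]
  rw [← tsum_fintype (L := .unconditional Ω), ENNReal.tsum_comm]
  refine tsum_congr fun T => ?_
  rw [tsum_fintype, Finset.card_filter, Nat.cast_sum, Finset.mul_sum]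
  refine Finset.sum_congr rfl fun ω _ => ?_
  by_cases h : T.run (I ω) = b
  · simp [h]
  · simp [h, Ne.symm h]

theorem numQueries_le {n d q : ℕ} {A : PMF (QueryAlg n d)} (hq : queryComplexity A ≤ (q : ℕ∞))
    {T : QueryAlg n d} (hT : T ∈ A.support) (I : LabeledGraph n d) : T.numQueries I ≤ q := by
  have h : (T.numQueries I : ℕ∞) ≤ queryComplexity A :=
    le_iSup_of_le I (le_iSup₂_of_le T hT le_rfl)
  exact_mod_cast h.trans hq

/-- Averaging in the manner of Yao: a tester's success probabilities on nested and crossed inputs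
sum to at least `4 / 3` on average, while each deterministic algorithm in its support achieves less
once `HitsBoth` has probability below `1 / 3`. The choice `L = q + 1` is the least that exceeds `q`.
-/
theorem IsDFSTester.le_queries {n d q : ℕ} {ε : ℝ} (hd : 3 ≤ d) (hε : ε ≤ 1 / 33)
    {A : PMF (QueryAlg n d)} (hA : IsDFSTester ε A) (hq : queryComplexity A ≤ (q : ℕ∞))
    (hn : 14 * (q + 1) ≤ n) : n - 2 * q ≤ 3 * (q * (q * (14 * (q + 1)))) := by
  classical
  by_contra! hlt
  have hL : 0 < q + 1 := q.succ_pos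
  set N := Fintype.card (Equiv.Perm (Fin n) × (Fin n → Bool)) with hN
  have hNpos : 0 < N := Fintype.card_pos
  -- The `- 1` records a strict inequality between integers, so that strictness survives the
  -- infinite sum over algorithms.
  have hT : ∀ T ∈ A.support,
      3 * ((Finset.univ.filter fun ω => T.run (nestedInput (n := n) hL hd ω) = true).card +
        (Finset.univ.filter fun ω => T.run (crossedInput (n := n) hL hd ω) = false).card) ≤
      4 * N - 1 := by
    intro T hT
    have h1 := card_run_eq_le (n := n) hL hd T
    have h2 := card_hitsBoth_le (n := n) hL hd q.lt_succ_self T (numQueries_le hq hT)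
    rw [← hN] at h1 h2
    set B := (Finset.univ.filter fun ω => HitsBoth (n := n) hL hd T ω).card
    have h3 : 3 * B < N := by
      by_contra! h
      have h4 : N * (n - 2 * q) ≤ N * (3 * (q * (q * (14 * (q + 1))))) :=
        calc N * (n - 2 * q) ≤ 3 * B * (n - 2 * q) := Nat.mul_le_mul_right _ h
          _ = 3 * (B * (n - 2 * q)) := mul_assoc _ _ _
          _ ≤ 3 * (q * (q * (14 * (q + 1))) * N) := Nat.mul_le_mul_left _ h2
          _ = N * (3 * (q * (q * (14 * (q + 1))))) := by ring
      exact absurd (Nat.le_of_mul_le_mul_left h4 hNpos) (not_le.2 hlt)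
    omega
  have h1 : (N : ENNReal) * (2 / 3) ≤ ∑ ω, outputProb A (nestedInput (n := n) hL hd ω) true := by
    rw [hN, ← Finset.card_univ, ← nsmul_eq_mul]
    exact Finset.card_nsmul_le_sum _ _ _ fun ω _ =>
      (hA _).1 (isDFSNumbering_nestedInput hL hd ω)
  have h2 : (N : ENNReal) * (2 / 3) ≤ ∑ ω, outputProb A (crossedInput (n := n) hL hd ω) false := by
    rw [hN, ← Finset.card_univ, ← nsmul_eq_mul]
    exact Finset.card_nsmul_le_sum _ _ _ fun ω _ =>
      (hA _).2 (isFar_crossedInput hL hd hn hε ω)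
  have h3 : 3 * (∑ ω, outputProb A (nestedInput (n := n) hL hd ω) true +
      ∑ ω, outputProb A (crossedInput (n := n) hL hd ω) false) ≤ ((4 * N - 1 : ℕ) : ENNReal) := by
    rw [sum_outputProb, sum_outputProb, ← ENNReal.tsum_add, ← ENNReal.tsum_mul_left]
    calc _ ≤ ∑' T, A T * ((4 * N - 1 : ℕ) : ENNReal) := by
          refine ENNReal.tsum_le_tsum fun T => ?_
          by_cases h : T ∈ A.support
          · rw [← mul_add, mul_left_comm]
            gcongr
            exact_mod_cast hT T h
          · rw [(PMF.apply_eq_zero_iff A T).2 h]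
            simp
      _ = ((4 * N - 1 : ℕ) : ENNReal) := by rw [ENNReal.tsum_mul_right, A.tsum_coe, one_mul]
  have h4 : ((4 * N : ℕ) : ENNReal) ≤ ((4 * N - 1 : ℕ) : ENNReal) := by
    refine le_trans (le_of_eq ?_) ((mul_le_mul_right (add_le_add h1 h2) 3).trans h3)
    have h5 : (3 : ENNReal) * (2 / 3) = 2 := ENNReal.mul_div_cancel (by simp) (by simp)
    calc ((4 * N : ℕ) : ENNReal) = N * 2 + N * 2 := by push_cast; ring
      _ = N * (3 * (2 / 3)) + N * (3 * (2 / 3)) := by rw [h5]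
      _ = 3 * (N * (2 / 3) + N * (2 / 3)) := by ring
  have h5 : 4 * N ≤ 4 * N - 1 := by exact_mod_cast h4
  omega

end DFSTesting

theorem mainTheorem2 :
    ∃ c : ℝ, 0 < c ∧ ∃ n₀ : ℕ, ∀ (d : ℕ), 3 ≤ d → ∀ (ε : ℝ), 0 < ε → ε ≤ 1 / 33 →
      ∀ (n : ℕ), n₀ ≤ n → ∀ A : PMF (DFSTesting.QueryAlg n d), DFSTesting.IsDFSTester ε A →
        ∀ q : ℕ, DFSTesting.queryComplexity A ≤ (q : ℕ∞) →
          c * (n : ℝ) ^ ((1 : ℝ) / 3) ≤ (q : ℝ) := by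
  -- With `c = 1 / 5`, failure means `125 * q ^ 3 < n`, while `le_queries` gives `n ≤ 42 * q ^ 3 +
  -- 42 * q ^ 2 + 2 * q ≤ 86 * q ^ 3` for `q ≥ 1`. The threshold `14` serves `q = 0`, where one full
  -- pair of blocks with `L = 1` must fit.
  refine ⟨1 / 5, by norm_num, 14, fun d hd ε _ hε n hn A hA q hq => ?_⟩
  by_contra! hlt
  have hcube : ((n : ℝ) ^ ((1 : ℝ) / 3)) ^ 3 = n := by
    rw [← Real.rpow_natCast, ← Real.rpow_mul (Nat.cast_nonneg n)]
    norm_num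
  have h1 : (125 : ℝ) * q ^ 3 < n := by
    have := pow_lt_pow_left₀ hlt (Nat.cast_nonneg q) three_ne_zero
    rw [mul_pow, hcube] at this
    linarith
  have h2 : 125 * q ^ 3 < n := by exact_mod_cast h1
  rcases Nat.eq_zero_or_pos q with rfl | hpos
  · have := hA.le_queries hd hε hq (by omega)
    omega
  · have h3 : q ≤ q ^ 2 := Nat.le_self_pow two_ne_zero q
    have h4 : q ^ 2 ≤ q ^ 3 := Nat.pow_le_pow_right hpos (by norm_num)
    have := hA.le_queries hd hε hq (by omega)
    have h5 : 3 * (q * (q * (14 * (q + 1)))) = 42 * q ^ 3 + 42 * q ^ 2 := by ring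
    omega
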